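/- Let $n,m\ge 1$ be integers, $\theta>0$, $g\in C^2(B_\theta)$ a real function on the open ball $B_\theta=B_\theta(0)\subset\mathbb R^m$, $x_0\in\mathbb R^n$ and $R>0$. Let $u:B_R(x_0)\to\mathbb R^m$ be continuous with $|u|<\theta$ in $B_R(x_0)$, let $u\in W^{1,2}_{loc}(B_R(x_0),\mathbb R^m)$, and let $u$ be a weak solution of $$\Delta u=g(u)\frac{u}{|u|}+|u|\,D_ug(u)\quad\text{in }B_R(x_0),$$ where the right-hand side is understood to be $0$ at points with $u=0$; that is, $\sum_i\int \partial_i\varphi\,\partial_iu\,dx=-\int\varphi\,\big(g(u)\frac{u}{|u|}+|u|D_ug(u)\big)dx$ for all $\varphi\in C_c^\infty(B_R(x_0))$. (This is the case $\alpha=1$ of the Euler-Lagrange system of $\int \frac12|\nabla u|^2+g(u)|u|^\alpha$.) For $0<r<R$ put $$W(u,x_0,r)=\frac1{r^{n+2}}\int_{B_r(x_0)}\Big(\frac12|\nabla u|^2+g(u)|u|\Big)dx-\frac1{r^{n+3}}\int_{\partial B_r(x_0)}|u|^2\,d\mathcal H^{n-1},\qquad u_r(x)=\frac{u(x_0+rx)}{r^2}.$$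 Then for every $r\in(0,R)$ the integrals in $W(u,x_0,r)$ and in the formula below converge absolutely, the derivative $\partial_ru_r(x)$ exists for every $|x|\le 1$, the function $s\mapsto W(u,x_0,s)$ is differentiable at $r$, and $$\frac{d}{dr}W(u,x_0,r)=r\int_{\partial B_1}|\partial_ru_r|^2\,d\mathcal H^{n-1}+2r\int_{B_1}\big(D_ug(u(x_0+rx))\cdot u_r(x)\big)\,|u_r(x)|\,dx.$$ -/

import Mathlib

open MeasureTheory Metric Set
open scoped ContDiff

namespace WeissFormula

/-- The Euclidean space of dimension `d`. -/
abbrev E (d : ℕ) : Type := EuclideanSpace ℝ (Fin d)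

/-- The partial derivative in the `i`-th coordinate direction of a scalar function. -/
noncomputable def partialDeriv {n : ℕ} (i : Fin n) (φ : E n → ℝ) (x : E n) : ℝ :=
  fderiv ℝ φ x (EuclideanSpace.single i 1)

/-- Test functions on `U`: smooth functions with compact support contained in `U`. -/
structure IsTestFunction {n : ℕ} (U : Set (E n)) (φ : E n → ℝ) : Prop where
  smooth : ContDiff ℝ ∞ φ
  compact : HasCompactSupport φ
  support : tsupport φ ⊆ U

/-- `u` belongs to `W^{1,2}_loc(U, ℝᵐ)` and `G i` is its weak partial derivative `∂ᵢ u`. -/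
structure IsW12Loc {n m : ℕ} (U : Set (E n)) (u : E n → E m) (G : Fin n → E n → E m) :
    Prop where
  memLp : ∀ K ⊆ U, IsCompact K → MemLp u 2 (volume.restrict K)
  memLp_grad : ∀ K ⊆ U, IsCompact K → ∀ i, MemLp (G i) 2 (volume.restrict K)
  weak_deriv : ∀ φ, IsTestFunction U φ → ∀ i,
    (∫ x in U, partialDeriv i φ x • u x) = - ∫ x in U, φ x • G i x

/-- The right-hand side `g(y) y/|y| + |y| D g(y)` of the Euler-Lagrange system; at `y = 0` its value
is `0`, so that the system reads `Δu = W_u(u) χ_{u ≠ 0}` with `W(y) = g(y)|y|`. -/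
noncomputable def rhs {m : ℕ} (g : E m → ℝ) (y : E m) : E m :=
  g y • (‖y‖⁻¹ • y) + ‖y‖ • gradient g y

/-- `u` is a (continuous, `W^{1,2}_loc`) weak solution of `Δu = g(u) u/|u| + |u| D g(u)` in `U`, with
weak gradient `G`. Strong solutions (`W^{2,p}_loc`, equation almost everywhere) are of this kind. -/
structure IsSolution {n m : ℕ} (g : E m → ℝ) (U : Set (E n)) (u : E n → E m)
    (G : Fin n → E n → E m) : Prop where
  continuousOn : ContinuousOn u U
  sobolev : IsW12Loc U u G
  equation : ∀ φ, IsTestFunction U φ →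
    (∑ i, ∫ x in U, partialDeriv i φ x • G i x) = - ∫ x in U, φ x • rhs g (u x)

/-- The surface measure of the sphere `∂B_r(x₀)`, as a measure on `ℝⁿ`: the image of Mathlib's surface
measure on the unit sphere under `ξ ↦ x₀ + r ξ`, multiplied by `r^{n-1}`. -/
noncomputable def surface {n : ℕ} (x₀ : E n) (r : ℝ) : Measure (E n) :=
  ENNReal.ofReal (r ^ (n - 1)) •
    ((volume : Measure (E n)).toSphere.map fun ξ : sphere (0 : E n) 1 => x₀ + r • (ξ : E n))

/-- The energy density `½|∇u|² + g(u)|u|`, where `∇u = (G i)ᵢ`. -/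
noncomputable def density {n m : ℕ} (g : E m → ℝ) (u : E n → E m) (G : Fin n → E n → E m)
    (x : E n) : ℝ :=
  1 / 2 * ∑ i, ‖G i x‖ ^ 2 + g (u x) * ‖u x‖

/-- The Weiss energy `W(u, x₀, r)`. -/
noncomputable def weiss {n m : ℕ} (g : E m → ℝ) (u : E n → E m) (G : Fin n → E n → E m)
    (x₀ : E n) (r : ℝ) : ℝ :=
  1 / r ^ (n + 2) * (∫ x in ball x₀ r, density g u G x)
    - 1 / r ^ (n + 3) * (∫ x, ‖u x‖ ^ 2 ∂(surface x₀ r))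

/-- The rescaling `u_r(x) = u(x₀ + r x) / r²`. -/
noncomputable def rescale {n m : ℕ} (u : E n → E m) (x₀ : E n) (r : ℝ) (x : E n) : E m :=
  (r ^ 2)⁻¹ • u (x₀ + r • x)

/-- The derivative `∂_r u_r(x)` with respect to the radius. -/
noncomputable def rescaleDeriv {n m : ℕ} (u : E n → E m) (x₀ : E n) (r : ℝ) (x : E n) : E m :=
  deriv (fun s => rescale u x₀ s x) r

/-- The error density `(D g(u(x₀ + r x)) · u_r(x)) |u_r(x)|`; here `u(x₀ + r x) = r² u_r(x)`. -/
noncomputable def errorDensity {n m : ℕ} (g : E m → ℝ) (u : E n → E m) (x₀ : E n) (r : ℝ)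
    (x : E n) : ℝ :=
  inner ℝ (gradient g (u (x₀ + r • x))) (rescale u x₀ r x) * ‖rescale u x₀ r x‖

end WeissFormula

namespace WeissFormula

open Filter Topology

/-! Write `u_s` for the rescaling of `u` to radius `s`. A change of variables turns the Weiss energy
at radius `s` into the integral of `½|∇u_s|² + s⁻² g(u)|u|` over the unit ball, with `u` taken at
`x₀ + s x`, minus the integral of `|u_s|²` over the unit sphere (`weiss_eq`). Formally,
differentiate in `s` and integrate by parts. On the sphere the normal derivative of `u_s` is `s ∂_s
u_s + 2 u_s`; the part `2 u_s` cancels the derivative of the boundary term, which leaves `s |∂_s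
u_s|²`. In the ball, `Δu_s = rhs g (u)` is paired with `∂_s u_s` and subtracted from the derivative
of the potential. The terms containing the gradient of `u` cancel, and what survives measures the
failure of `g(y)|y|` to be 1-homogeneous, namely the error density
(`potentialDeriv_limit_identity`).

Two things obstruct this computation: `u` need not have classical second derivatives, and `g(y)|y|`
need not be differentiable at `0`. Hence `u` is mollified to smooth `v_k` in the Dirichlet and
boundary terms, `|y|` is replaced by `√(|y|² + δ_k²)` in the potential, and the potential is still
evaluated at `u` itself. The energies so obtained have an explicit derivative
(`hasDerivAt_smooth_energy`, `hasDerivAt_integral_potential`). On radii bounded away from `0` these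
derivatives are uniformly bounded and converge pointwise to the continuous right-hand side, so the
fundamental theorem of calculus passes to the limit (`hasDerivAt_of_tendsto_of_bounded`).

The limit needs `v_k → u` together with first derivatives, and bounded Laplacians converging almost
everywhere. The Laplacians are mollifications of the bounded function `rhs g (u)`. Convergence of
the gradients follows from the elementary estimate `|∂ᵢv| ≤ n M / d + N d / 2` for `|v| ≤ M`, `|Δv|
≤ N`, applied to `v_k - v_l`; it is proved with a barrier and the maximum principle, and also shows
that `u` is `C¹` (`IsSolution.exists_approximation`). -/

/-- The `i`-th coordinate vector. -/
noncomputable abbrev basisVec {n : ℕ} (i : Fin n) : E n := EuclideanSpace.single i (1 : ℝ)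

/-- The `i`-th partial derivative of a vector-valued function. -/
noncomputable def vpartial {n : ℕ} {F : Type*} [NormedAddCommGroup F] [NormedSpace ℝ F]
    (i : Fin n) (v : E n → F) (x : E n) : F :=
  fderiv ℝ v x (basisVec i)

/-- The Laplacian of a vector-valued function. -/
noncomputable def lap {n : ℕ} {F : Type*} [NormedAddCommGroup F] [NormedSpace ℝ F]
    (v : E n → F) (x : E n) : F :=
  ∑ i, vpartial i (vpartial i v) x

/-! ### Maximum principle and interior gradient estimate for scalar functions. -/

section Calculus

variable {n : ℕ} {F : Type*} [NormedAddCommGroup F] [NormedSpace ℝ F]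

lemma contDiff_vpartial {v : E n → F} {k l : WithTop ℕ∞} (hv : ContDiff ℝ l v) (hkl : k + 1 ≤ l)
    (i : Fin n) : ContDiff ℝ k (vpartial i v) :=
  (hv.fderiv_right hkl).clm_apply contDiff_const

/-- The factor `c` will be `1` or `-1`, the latter for lines seen through a reflection. -/
lemma hasDerivAt_line {v : E n → F} (hv : Differentiable ℝ v) (p : E n) (i : Fin n) (c : ℝ) :
    HasDerivAt (fun t : ℝ => v (p + (c * t) • basisVec i)) (c • vpartial i v p) 0 := by
  have h1 : HasDerivAt (fun t : ℝ => p + (c * t) • basisVec i) (c • basisVec i) 0 := by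
    have := (((hasDerivAt_id (0 : ℝ)).const_mul c).smul_const (basisVec i)).const_add p
    simpa using this
  have h2 : HasFDerivAt v (fderiv ℝ v p) (p + (c * 0) • basisVec i) := by
    simpa using (hv p).hasFDerivAt
  have := h2.comp_hasDerivAt (0 : ℝ) h1
  simpa [vpartial, Function.comp_def] using this

end Calculus

/-- If `f₂` were positive, the second derivative test would make `x` a local minimum as well; then
`f` is constant near `x`, so `f₁` vanishes there and `f₂ = 0`. -/
lemma second_deriv_nonpos_of_isLocalMax {f f₁ : ℝ → ℝ} {x f₂ : ℝ}
    (h1 : ∀ t, HasDerivAt f (f₁ t) t) (h2 : HasDerivAt f₁ f₂ x) (hmax : IsLocalMax f x) :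
    f₂ ≤ 0 := by
  by_contra! hpos
  have hd : deriv f = f₁ := funext fun t => (h1 t).deriv
  have h0 : deriv f x = 0 := hmax.deriv_eq_zero
  have hmin : IsLocalMin f x := by
    apply isLocalMin_of_deriv_deriv_pos _ h0 (h1 x).continuousAt
    rw [hd, h2.deriv]; exact hpos
  have hc : f =ᶠ[𝓝 x] fun _ => f x := by
    filter_upwards [hmax, hmin] with t ht ht' using le_antisymm ht ht'
  have hc1 : f₁ =ᶠ[𝓝 x] fun _ => 0 := by
    have := hc.deriv
    rw [hd] at this
    simpa using this
  have := h2.congr_of_eventuallyEq hc1.symm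
  have := this.unique (hasDerivAt_const x (0 : ℝ))
  linarith

/-- A weak maximum principle: strict subsolutions attain their maximum at the boundary. -/
lemma nonpos_of_laplacian_pos {n : ℕ} {K O : Set (E n)} (hK : IsCompact K) (hO : IsOpen O)
    (hOK : O ⊆ K) {φ : E n → ℝ} {φ₁ φ₂ : Fin n → E n → ℝ} (hφ : ContinuousOn φ K)
    (h1 : ∀ p j, HasDerivAt (fun t : ℝ => φ (p + t • basisVec j)) (φ₁ j p) 0)
    (h2 : ∀ p j, HasDerivAt (fun t : ℝ => φ₁ j (p + t • basisVec j)) (φ₂ j p) 0)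
    (hpos : ∀ p ∈ O, 0 < ∑ j, φ₂ j p) (hbd : ∀ p ∈ K, p ∉ O → φ p ≤ 0) :
    ∀ p ∈ K, φ p ≤ 0 := by
  intro q hq
  obtain ⟨p, hp, hmax⟩ := hK.exists_isMaxOn ⟨q, hq⟩ hφ
  refine (hmax hq).trans ?_
  by_cases hpO : p ∈ O
  swap
  · exact hbd p hp hpO
  exfalso
  have hloc : IsLocalMax φ p := by
    filter_upwards [hO.mem_nhds hpO] with y hy using hmax (hOK hy)
  refine (hpos p hpO).not_ge (Finset.sum_nonpos fun j _ => ?_)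
  have hcont : Tendsto (fun t : ℝ => p + t • basisVec j) (𝓝 0) (𝓝 p) := by
    have : Continuous (fun t : ℝ => p + t • basisVec j) := by fun_prop
    simpa using this.tendsto 0
  refine second_deriv_nonpos_of_isLocalMax (f := fun t : ℝ => φ (p + t • basisVec j))
    (f₁ := fun t => φ₁ j (p + t • basisVec j)) (x := 0) (fun t => ?_) (h2 p j) ?_
  -- `h1` differentiates only at parameter `0` but from every base point; moving the base point
  -- gives the derivative at `t`.
  · have := h1 (p + t • basisVec j) j
    have h3 : HasDerivAt (fun s : ℝ => s - t) 1 t := (hasDerivAt_id t).sub_const t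
    have h4 := HasDerivAt.scomp_of_eq t this h3 (by simp)
    refine (h4.congr_deriv (by simp)).congr_of_eventuallyEq (Eventually.of_forall fun s => ?_)
    simp only [Function.comp]
    congr 1
    rw [add_assoc, ← add_smul]; simp
  · have := hcont.eventually hloc
    simpa [IsLocalMax, IsMaxFilter] using this

lemma deriv_nonneg_of_nonneg_right {k : ℝ → ℝ} {k' d : ℝ} (hd : 0 < d) (hk : HasDerivAt k k' 0)
    (h0 : k 0 = 0) (hpos : ∀ t ∈ Icc 0 d, 0 ≤ k t) : 0 ≤ k' := by
  have h := (hasDerivWithinAt_iff_tendsto_slope' (s := Ioi (0:ℝ)) (by simp)).1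
    (hk.hasDerivWithinAt (s := Ioi 0))
  refine ge_of_tendsto h ?_
  filter_upwards [Ioo_mem_nhdsGT hd] with t ht
  rw [slope_def_field, h0]
  have := hpos t ⟨ht.1.le, ht.2.le⟩
  exact div_nonneg (by linarith) (by linarith [ht.1])

/-- One-sided interior gradient estimate for the Poisson equation. -/
lemma vpartial_le_of_bounds {n : ℕ} {v : E n → ℝ} (hv : ContDiff ℝ 2 v) (x : E n) (i : Fin n)
    {d M N : ℝ} (hd : 0 < d) (hM : ∀ y : E n, (∀ j, |y j| ≤ d) → |v (x + y)| ≤ M)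
    (hN : ∀ y : E n, (∀ j, |y j| ≤ d) → |lap v (x + y)| < N) :
    vpartial i v x ≤ n * M / d + N * d / 2 := by
  have hM0 : 0 ≤ M := (abs_nonneg _).trans (hM 0 (by simp [hd.le]))
  have hN0 : 0 < N := (abs_nonneg _).trans_lt (hN 0 (by simp [hd.le]))
  -- Coefficients of the barrier `ψ = a|y|² + b yᵢ - c yᵢ²` on the half cube `|yⱼ| ≤ d`, `yᵢ ≥ 0`.
  -- `a d² = M` gives `a|y|² ≥ M` on the faces `|yⱼ| = d`; `b = c d` makes `b yᵢ - c yᵢ² = c yᵢ (d -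
  -- yᵢ)` nonnegative; and `Δψ = 2na - 2c = -N`. The slope of `ψ` in direction `i` at `0` is `b`,
  -- the bound to be proved.
  set a := M / d ^ 2 with ha
  set b := n * M / d + N * d / 2 with hb
  set c := n * M / d ^ 2 + N / 2 with hc
  have ha0 : 0 ≤ a := by positivity
  have had : a * d ^ 2 = M := by rw [ha]; field_simp
  have hbc : b = c * d := by rw [hb, hc]; field_simp
  have hca : 2 * n * a - 2 * c = - N := by rw [ha, hc]; ring
  -- Reflection in `yᵢ = 0`. The odd part of `v` under `σ` vanishes on the flat face, so nothing
  -- need be known there, and its `i`-th derivative at the centre is that of `v`.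
  let σ : E n → E n := fun y => y - (2 * y i) • basisVec i
  let s : Fin n → ℝ := fun j => if j = i then -1 else 1
  have hs2 : ∀ j, s j * s j = 1 := fun j => by simp only [s]; split_ifs <;> norm_num
  have hσl : ∀ (y : E n) (j : Fin n) (t : ℝ),
      σ (y + t • basisVec j) = σ y + (s j * t) • basisVec j := by
    intro y j t
    ext k
    by_cases hji : j = i
    · subst hji
      simp only [σ, s, PiLp.sub_apply, PiLp.add_apply, PiLp.smul_apply, PiLp.single_apply,
        smul_eq_mul]
      split_ifs <;> ring
    · simp [σ, s, hji, Ne.symm hji]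
      ring
  have hσabs : ∀ y : E n, ∀ j, |σ y j| = |y j| := by
    intro y j
    by_cases hji : j = i
    · subst hji
      simp only [σ, PiLp.sub_apply, PiLp.smul_apply, PiLp.single_apply, if_true]
      rw [← abs_neg]; congr 1; simp; ring
    · simp [σ, hji]
  have hvd : Differentiable ℝ v := hv.differentiable (by norm_num)
  have hv1 : ∀ j, Differentiable ℝ (vpartial j v) := fun j =>
    (contDiff_vpartial (k := 1) hv (by norm_num) j).differentiable (by norm_num)
  let ψ : E n → ℝ := fun y => a * ∑ j, y j ^ 2 + b * y i - c * y i ^ 2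
  let φ : E n → ℝ := fun y => (v (x + y) - v (x + σ y)) / 2 - ψ y
  let δ : Fin n → ℝ := fun j => if j = i then 1 else 0
  let φ₁ : Fin n → E n → ℝ := fun j y =>
    (vpartial j v (x + y) - s j * vpartial j v (x + σ y)) / 2
      - (2 * a * y j + (b - 2 * c * y i) * δ j)
  let φ₂ : Fin n → E n → ℝ := fun j y =>
    (vpartial j (vpartial j v) (x + y) - vpartial j (vpartial j v) (x + σ y)) / 2
      - (2 * a - 2 * c * δ j)
  have hδ2 : ∀ j, δ j * δ j = δ j := fun j => by simp only [δ]; split_ifs <;> norm_num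
  have hcoord : ∀ (p : E n) (j k : Fin n),
      HasDerivAt (fun t : ℝ => (p + t • basisVec j) k) (if k = j then 1 else 0) 0 := by
    intro p j k
    have : HasDerivAt (fun t : ℝ => p k + t * (if k = j then 1 else 0))
        (1 * (if k = j then 1 else 0)) 0 :=
      ((hasDerivAt_id (0:ℝ)).mul_const _).const_add _
    simpa [PiLp.single_apply] using this
  have hl : ∀ (w : E n → ℝ), Differentiable ℝ w → ∀ (p : E n) (j : Fin n),
      HasDerivAt (fun t : ℝ => w (x + (p + t • basisVec j))) (vpartial j w (x + p)) 0 := by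
    intro w hw p j
    have := hasDerivAt_line hw (x + p) j 1
    simpa [add_assoc] using this
  have hlσ : ∀ (w : E n → ℝ), Differentiable ℝ w → ∀ (p : E n) (j : Fin n),
      HasDerivAt (fun t : ℝ => w (x + σ (p + t • basisVec j)))
        (s j * vpartial j w (x + σ p)) 0 := by
    intro w hw p j
    have := hasDerivAt_line hw (x + σ p) j (s j)
    simp only [hσl]
    simpa [add_assoc] using this
  have h1 : ∀ p j, HasDerivAt (fun t : ℝ => φ (p + t • basisVec j)) (φ₁ j p) 0 := by
    intro p j
    have hsum : HasDerivAt (fun t : ℝ => ∑ k, ((p + t • basisVec j) k) ^ 2) (2 * p j) 0 := by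
      have := HasDerivAt.fun_sum (u := Finset.univ) fun k _ => (hcoord p j k).pow 2
      refine this.congr_deriv ?_
      simp
    have h := (((hl v hvd p j).sub (hlσ v hvd p j)).div_const 2).sub
      (((hsum.const_mul a).add ((hcoord p j i).const_mul b)).sub
        (((hcoord p j i).pow 2).const_mul c))
    refine h.congr_deriv ?_
    simp [φ₁, δ, eq_comm (a := i)]
    split_ifs <;> ring
  have h2 : ∀ p j, HasDerivAt (fun t : ℝ => φ₁ j (p + t • basisVec j)) (φ₂ j p) 0 := by
    intro p j
    have h := (((hl _ (hv1 j) p j).sub ((hlσ _ (hv1 j) p j).const_mul (s j))).div_const 2).sub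
      (((hcoord p j j).const_mul (2 * a)).add
        ((((hcoord p j i).const_mul (2 * c)).const_sub b).mul_const (δ j)))
    refine h.congr_deriv ?_
    rw [← mul_assoc (s j), hs2]
    have : (if i = j then (1:ℝ) else 0) = δ j := by simp [δ, eq_comm]
    simp only [this, φ₂]
    have := hδ2 j
    simp
    linear_combination (-(2 * c)) * this
  let K : Set (E n) := {y | (∀ j, |y j| ≤ d) ∧ 0 ≤ y i}
  let O : Set (E n) := {y | (∀ j, |y j| < d) ∧ 0 < y i}
  have hcy : ∀ j, Continuous (fun y : E n => y j) := fun j => by fun_prop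
  have hK : IsCompact K := by
    refine Metric.isCompact_of_isClosed_isBounded ?_ ?_
    · refine IsClosed.inter ?_ (isClosed_le continuous_const (hcy i))
      have : {y : E n | ∀ j, |y j| ≤ d} = ⋂ j, {y : E n | |y j| ≤ d} := by ext; simp
      rw [show (fun y : E n => ∀ j, |y j| ≤ d) = {y : E n | ∀ j, |y j| ≤ d} from rfl, this]
      exact isClosed_iInter fun j => isClosed_le (hcy j).abs continuous_const
    · refine (Metric.isBounded_closedBall (x := (0 : E n)) (r := √(n * d ^ 2))).subset ?_
      intro y hy
      rw [mem_closedBall_zero_iff, EuclideanSpace.norm_eq]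
      apply Real.sqrt_le_sqrt
      calc ∑ j, ‖y j‖ ^ 2 ≤ ∑ _j : Fin n, d ^ 2 := by
            gcongr with j
            exact hy.1 j
        _ = n * d ^ 2 := by simp
  have hO : IsOpen O := by
    refine IsOpen.inter ?_ (isOpen_lt continuous_const (hcy i))
    have : {y : E n | ∀ j, |y j| < d} = ⋂ j, {y : E n | |y j| < d} := by ext; simp
    rw [show (fun y : E n => ∀ j, |y j| < d) = {y : E n | ∀ j, |y j| < d} from rfl, this]
    exact isOpen_iInter_of_finite fun j => isOpen_lt (hcy j).abs continuous_const
  have hOK : O ⊆ K := fun y hy => ⟨fun j => (hy.1 j).le, hy.2.le⟩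
  have hσc : Continuous σ := by fun_prop
  have hφc : Continuous φ := by
    have := hv.continuous
    fun_prop
  have key := nonpos_of_laplacian_pos hK hO hOK hφc.continuousOn h1 h2 ?_ ?_
  -- `k` is `-φ` along the `i`-th axis: nonnegative to the right of `0` and zero at `0`.
  · let k : ℝ → ℝ := fun t => b * t + (a - c) * t ^ 2 - (v (x + t • basisVec i)
        - v (x + (-1 * t) • basisVec i)) / 2
    have hk : HasDerivAt k (b - vpartial i v x) 0 := by
      have h3 := hasDerivAt_line hvd x i 1
      have h4 := hasDerivAt_line hvd x i (-1)
      simp only [one_mul] at h3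
      have := ((((hasDerivAt_id (0:ℝ)).const_mul b).add
        (((hasDerivAt_id (0:ℝ)).pow 2).const_mul (a - c))).sub ((h3.sub h4).div_const 2))
      refine this.congr_deriv ?_
      simp
    have := deriv_nonneg_of_nonneg_right hd hk (by simp [k]) ?_
    · linarith
    · intro t ht
      have htK : t • basisVec i ∈ K := by
        refine ⟨fun j => ?_, ?_⟩
        · by_cases hji : j = i
          · simpa [hji, abs_of_nonneg ht.1] using ht.2
          · simpa [hji] using hd.le
        · simpa using ht.1
      have hkk := key _ htK
      have hσt : σ (t • basisVec i) = (-1 * t) • basisVec i := by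
        have := hσl 0 i t
        simpa [σ, s] using this
      simp only [φ, ψ, hσt] at hkk
      have hsum : ∑ j, ((t • basisVec i : E n) j) ^ 2 = t ^ 2 := by
        simp [PiLp.single_apply]
      rw [hsum] at hkk
      simp only [PiLp.smul_apply, PiLp.single_apply, if_true, smul_eq_mul, mul_one]
        at hkk
      simp only [k]
      linarith
  · intro p hp
    have e1 : ∑ j, φ₂ j p = (lap v (x + p) - lap v (x + σ p)) / 2 - (2 * n * a - 2 * c) := by
      simp only [φ₂, lap, Finset.sum_sub_distrib, ← Finset.sum_div, ← Finset.mul_sum]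
      simp [δ]
      ring
    rw [e1, hca]
    have b1 := abs_lt.1 (hN p fun j => (hp.1 j).le)
    have b2 := abs_lt.1 (hN (σ p) fun j => by rw [hσabs]; exact (hp.1 j).le)
    linarith [b1.1, b2.2]
  · intro p hp hpO
    have hpi : 0 ≤ p i := hp.2
    have hpd : p i ≤ d := (le_abs_self _).trans (hp.1 i)
    have hsum0 : ∀ j, p j ^ 2 ≤ ∑ j, p j ^ 2 := fun j =>
      Finset.single_le_sum (f := fun j => p j ^ 2) (fun _ _ => sq_nonneg _) (Finset.mem_univ j)
    have b1 := abs_le.1 (hM p hp.1)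
    have b2 := abs_le.1 (hM (σ p) fun j => by rw [hσabs]; exact hp.1 j)
    have hbc' : 0 ≤ b * p i - c * p i ^ 2 := by
      rw [hbc]
      have hc0 : 0 ≤ c := by positivity
      have : 0 ≤ c * (p i * (d - p i)) := by
        apply mul_nonneg hc0 (mul_nonneg hpi (by linarith))
      linarith
    have hfin : ∀ j, |p j| = d → φ p ≤ 0 := by
      intro j hj
      have : p j ^ 2 = d ^ 2 := by rw [← sq_abs, hj]
      have h5 : M ≤ a * ∑ j, p j ^ 2 := by
        rw [← had]
        exact mul_le_mul_of_nonneg_left (this ▸ hsum0 j) ha0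
      simp only [φ, ψ]
      linarith [b1.2, b2.1]
    by_cases hex : ∃ j, |p j| = d
    · obtain ⟨j, hj⟩ := hex
      exact hfin j hj
    · push Not at hex
      have hp0 : p i = 0 := by
        by_contra hne
        exact hpO ⟨fun j => lt_of_le_of_ne (hp.1 j) (hex j), lt_of_le_of_ne hpi (Ne.symm hne)⟩
      have hσp : σ p = p := by simp [σ, hp0]
      simp only [φ, ψ, hσp, hp0]
      have : 0 ≤ a * ∑ j, p j ^ 2 := mul_nonneg ha0 (Finset.sum_nonneg fun _ _ => sq_nonneg _)
      simp
      linarith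

/-! ### Gradient estimate for vector-valued maps. -/

section Inner

variable {n : ℕ} {F : Type*} [NormedAddCommGroup F] [InnerProductSpace ℝ F]

lemma vpartial_inner_const {v : E n → F} (hv : Differentiable ℝ v) (e : F) (i : Fin n) (x : E n) :
    vpartial i (fun y => inner ℝ e (v y)) x = inner ℝ e (vpartial i v x) := by
  have h : HasFDerivAt (fun y => inner ℝ e (v y)) ((innerSL ℝ e).comp (fderiv ℝ v x)) x :=
    (innerSL ℝ e).hasFDerivAt.comp x (hv x).hasFDerivAt
  simp [vpartial, h.fderiv]

lemma lap_inner_const {v : E n → F} (hv : ContDiff ℝ 2 v) (e : F) (x : E n) :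
    lap (fun y => inner ℝ e (v y)) x = inner ℝ e (lap v x) := by
  have hv1 : ∀ j, Differentiable ℝ (vpartial j v) := fun j =>
    (contDiff_vpartial (k := 1) hv (by norm_num) j).differentiable (by norm_num)
  have h1 : ∀ i, vpartial i (fun y => inner ℝ e (v y)) = fun y => inner ℝ e (vpartial i v y) :=
    fun i => funext fun y => vpartial_inner_const (hv.differentiable (by norm_num)) e i y
  simp only [lap, h1, inner_sum]
  exact Finset.sum_congr rfl fun i _ => vpartial_inner_const (hv1 i) e i x

lemma norm_le_sum_abs (y : E n) : ‖y‖ ≤ ∑ j, |y j| := by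
  rw [EuclideanSpace.norm_eq]
  refine Real.sqrt_le_iff.2 ⟨Finset.sum_nonneg fun _ _ => abs_nonneg _, ?_⟩
  simpa using Finset.sum_sq_le_sq_sum_of_nonneg (s := Finset.univ) (f := fun j => |y j|)
    (fun _ _ => abs_nonneg _)

/-- Interior gradient estimate for the Poisson equation. -/
lemma norm_vpartial_le_of_bounds {v : E n → F} (hv : ContDiff ℝ 2 v) (x : E n) (i : Fin n)
    {d M N : ℝ} (hd : 0 < d) (hM : ∀ z ∈ closedBall x (n * d), ‖v z‖ ≤ M)
    (hN : ∀ z ∈ closedBall x (n * d), ‖lap v z‖ ≤ N) :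
    ‖vpartial i v x‖ ≤ n * M / d + N * d / 2 := by
  have hx : x ∈ closedBall x (n * d) := mem_closedBall_self (by positivity)
  have hM0 : 0 ≤ M := (norm_nonneg _).trans (hM x hx)
  have hN0 : 0 ≤ N := (norm_nonneg _).trans (hN x hx)
  rcases eq_or_ne (vpartial i v x) 0 with h0 | h0
  · rw [h0, norm_zero]; positivity
  -- Pairing with the unit vector along `∂ᵢv(x)` reduces to a scalar function with the same bounds
  -- and loses nothing at `x`.
  set e : F := ‖vpartial i v x‖⁻¹ • vpartial i v x with he
  have he1 : ‖e‖ = 1 := by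
    rw [he, norm_smul, norm_inv, norm_norm, inv_mul_cancel₀ (norm_ne_zero_iff.2 h0)]
  have hmem : ∀ y : E n, (∀ j, |y j| ≤ d) → x + y ∈ closedBall x (n * d) := by
    intro y hy
    rw [mem_closedBall, dist_eq_norm, add_sub_cancel_left]
    calc ‖y‖ ≤ ∑ j, |y j| := norm_le_sum_abs y
      _ ≤ ∑ _j : Fin n, d := Finset.sum_le_sum fun j _ => hy j
      _ = n * d := by simp
  have hin : ∀ w : F, |inner ℝ e w| ≤ ‖w‖ := fun w => by
    simpa [he1] using abs_real_inner_le_norm e w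
  -- The scalar estimate wants a strict bound on the Laplacian; `ε` provides it and is then sent to
  -- `0`.
  have key : ∀ ε > 0, ‖vpartial i v x‖ ≤ n * M / d + (N + ε) * d / 2 := by
    intro ε hε
    have h := vpartial_le_of_bounds (v := fun y => inner ℝ e (v y)) (contDiff_const.inner ℝ hv)
      x i (M := M) (N := N + ε) hd (fun y hy => (hin _).trans (hM _ (hmem y hy))) (fun y hy => by
        rw [lap_inner_const hv]
        exact ((hin _).trans (hN _ (hmem y hy))).trans_lt (by linarith))
    rw [vpartial_inner_const (hv.differentiable (by norm_num)), he, real_inner_smul_left,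
      real_inner_self_eq_norm_sq] at h
    have : ‖vpartial i v x‖⁻¹ * ‖vpartial i v x‖ ^ 2 = ‖vpartial i v x‖ := by
      field_simp
    rwa [this] at h
  refine le_of_forall_pos_le_add fun ε hε => ?_
  have := key (ε * 2 / d) (by positivity)
  calc _ ≤ _ := this
    _ = _ := by field_simp; ring

end Inner

/-! ### Mollification of weak derivatives and of the weak equation. -/

open scoped Convolution

open ContinuousLinearMap (lsmul)

section Mollification

variable {n m : ℕ}

lemma vpartial_convolution {ρ : E n → ℝ} (hρ : ContDiff ℝ 1 ρ) (hc : HasCompactSupport ρ)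
    {w : E n → E m} (hw : LocallyIntegrable w) (i : Fin n) :
    vpartial i (ρ ⋆[lsmul ℝ ℝ] w) = (vpartial i ρ ⋆[lsmul ℝ ℝ] w) := by
  ext1 x
  have h := hc.hasFDerivAt_convolution_left (lsmul ℝ ℝ) hρ hw x (μ := volume)
  rw [vpartial, h.fderiv, convolution, convolution, ContinuousLinearMap.integral_apply]
  · rfl
  · exact (hc.fderiv (𝕜 := ℝ)).convolutionExists_left _ (hρ.continuous_fderiv one_ne_zero) hw x

/-- The value of a convolution at `x` is a pairing with this reflected kernel, so the weak
formulations can be applied point by point. -/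
lemma isTestFunction_reflect {U : Set (E n)} {ρ : E n → ℝ} (hρ : ContDiff ℝ ∞ ρ) {ε : ℝ}
    (hsupp : tsupport ρ ⊆ closedBall 0 ε) {x : E n} (hx : closedBall x ε ⊆ U) :
    IsTestFunction U (fun y => ρ (x - y)) := by
  have hts : tsupport (fun y => ρ (x - y)) ⊆ closedBall x ε := by
    refine closure_minimal (fun y hy => ?_) isClosed_closedBall
    have := hsupp (subset_closure (show x - y ∈ Function.support ρ from hy))
    rw [mem_closedBall_zero_iff] at this
    rwa [mem_closedBall, dist_comm, dist_eq_norm]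
  refine ⟨hρ.comp (contDiff_const.sub contDiff_id), ?_, hts.trans hx⟩
  exact IsCompact.of_isClosed_subset (isCompact_closedBall x ε) (isClosed_tsupport _) hts

lemma partialDeriv_reflect {ρ : E n → ℝ} (hρ : Differentiable ℝ ρ) (x y : E n) (i : Fin n) :
    partialDeriv i (fun y => ρ (x - y)) y = - vpartial i ρ (x - y) := by
  have h : HasFDerivAt (fun y => ρ (x - y))
      ((fderiv ℝ ρ (x - y)).comp (-ContinuousLinearMap.id ℝ (E n))) y :=
    (hρ (x - y)).hasFDerivAt.comp y ((hasFDerivAt_id y).const_sub x)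
  simp [partialDeriv, vpartial, h.fderiv]

lemma tsupport_vpartial_subset {F : Type*} [NormedAddCommGroup F] [NormedSpace ℝ F]
    {ρ : E n → F} (i : Fin n) : tsupport (vpartial i ρ) ⊆ tsupport ρ := by
  refine (closure_mono (fun x hx => ?_)).trans (tsupport_fderiv_subset ℝ (f := ρ))
  intro h0
  exact hx (by simp [vpartial, h0])

/-- Integrability is available only on compact subsets of `U`, so functions are cut off to `K`
before convolving; the kernel centred at `x` does not see the cut. -/
lemma convolution_indicator_eq {U K : Set (E n)} (hU : MeasurableSet U) (hKU : K ⊆ U)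
    {ρ : E n → ℝ} {ε : ℝ} (hsupp : tsupport ρ ⊆ closedBall 0 ε) {x : E n}
    (hx : closedBall x ε ⊆ K) (h : E n → E m) :
    (ρ ⋆[lsmul ℝ ℝ] K.indicator h) x = ∫ y in U, ρ (x - y) • h y := by
  rw [convolution_lsmul_swap, ← integral_indicator hU]
  refine integral_congr_ae (Eventually.of_forall fun y => ?_)
  by_cases hy : y ∈ K
  · simp [hy, hKU hy]
  · have : ρ (x - y) = 0 := by
      by_contra hne
      have := hsupp (subset_closure (show x - y ∈ Function.support ρ from hne))
      rw [mem_closedBall_zero_iff, ← dist_eq_norm, dist_comm] at this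
      exact hy (hx this)
    by_cases hyU : y ∈ U <;> simp [hy, this, hyU]

variable {g : E m → ℝ} {U K : Set (E n)} {u : E n → E m} {G : Fin n → E n → E m}

lemma IsW12Loc.integrableOn (hu : IsW12Loc U u G) (hKU : K ⊆ U) (hK : IsCompact K) :
    IntegrableOn u K := by
  have : Fact (volume K < ⊤) := ⟨hK.measure_lt_top⟩
  exact (hu.memLp K hKU hK).integrable (by norm_num)

lemma IsW12Loc.integrableOn_grad (hu : IsW12Loc U u G) (hKU : K ⊆ U) (hK : IsCompact K)
    (i : Fin n) : IntegrableOn (G i) K := by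
  have : Fact (volume K < ⊤) := ⟨hK.measure_lt_top⟩
  exact (hu.memLp_grad K hKU hK i).integrable (by norm_num)

lemma IsW12Loc.vpartial_mollify (hu : IsW12Loc U u G) (hU : MeasurableSet U) (hKU : K ⊆ U)
    (hK : IsCompact K) {ρ : E n → ℝ} (hρ : ContDiff ℝ ∞ ρ) {ε : ℝ}
    (hsupp : tsupport ρ ⊆ closedBall 0 ε) {x : E n} (hx : closedBall x ε ⊆ K) (i : Fin n) :
    vpartial i (ρ ⋆[lsmul ℝ ℝ] K.indicator u) x = (ρ ⋆[lsmul ℝ ℝ] K.indicator (G i)) x := by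
  have hcs : HasCompactSupport ρ :=
    IsCompact.of_isClosed_subset (isCompact_closedBall 0 ε) (isClosed_tsupport _) hsupp
  have hint : LocallyIntegrable (K.indicator u) :=
    ((integrable_indicator_iff hK.measurableSet).2 (hu.integrableOn hKU hK)).locallyIntegrable
  rw [vpartial_convolution (hρ.of_le (by norm_cast)) hcs hint,
    convolution_indicator_eq hU hKU ((tsupport_vpartial_subset i).trans hsupp) hx,
    convolution_indicator_eq hU hKU hsupp hx]
  have := hu.weak_deriv _ (isTestFunction_reflect hρ hsupp (hx.trans hKU)) i
  simp only [partialDeriv_reflect (hρ.differentiable (by simp)), neg_smul, integral_neg,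
    neg_inj] at this
  exact this

/-- One derivative is put on `ρ`; the other is turned into `G i` by the weak derivative with kernel
`∂ᵢρ`. The sum over `i` is then the weak equation tested with the reflected kernel. -/
lemma IsSolution.lap_mollify (hu : IsSolution g U u G) (hU : MeasurableSet U) (hKU : K ⊆ U)
    (hK : IsCompact K) {ρ : E n → ℝ} (hρ : ContDiff ℝ ∞ ρ) {ε : ℝ}
    (hsupp : tsupport ρ ⊆ closedBall 0 ε) {x : E n} (hx : closedBall x ε ⊆ K) :
    lap (ρ ⋆[lsmul ℝ ℝ] K.indicator u) x
      = (ρ ⋆[lsmul ℝ ℝ] K.indicator (fun y => rhs g (u y))) x := by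
  have hcs : HasCompactSupport ρ :=
    IsCompact.of_isClosed_subset (isCompact_closedBall 0 ε) (isClosed_tsupport _) hsupp
  have hint : LocallyIntegrable (K.indicator u) :=
    ((integrable_indicator_iff hK.measurableSet).2
      (hu.sobolev.integrableOn hKU hK)).locallyIntegrable
  have hρ1 : ∀ i, ContDiff ℝ ∞ (vpartial i ρ) := fun i => contDiff_vpartial hρ (by simp) i
  have hs1 : ∀ i, tsupport (vpartial i ρ) ⊆ closedBall 0 ε := fun i =>
    (tsupport_vpartial_subset i).trans hsupp
  have heq := hu.equation _ (isTestFunction_reflect hρ hsupp (hx.trans hKU))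
  rw [convolution_indicator_eq hU hKU hsupp hx]
  rw [eq_neg_iff_add_eq_zero, add_comm, ← eq_neg_iff_add_eq_zero] at heq
  rw [heq, lap, ← Finset.sum_neg_distrib]
  refine Finset.sum_congr rfl fun i _ => ?_
  rw [vpartial_convolution (hρ.of_le (by norm_cast)) hcs hint,
    hu.sobolev.vpartial_mollify hU hKU hK (hρ1 i) (hs1 i) hx,
    convolution_indicator_eq hU hKU (hs1 i) hx]
  simp only [partialDeriv_reflect (hρ.differentiable (by simp)), neg_smul, integral_neg, neg_neg]

end Mollification

/-! ### Measurability and bounds for the right-hand side. -/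

section Gradient

variable {n m : ℕ} {g : E m → ℝ} {θ : ℝ} {U K : Set (E n)} {u : E n → E m}

lemma continuousOn_gradient (hg : ContDiffOn ℝ 2 g (ball 0 θ)) :
    ContinuousOn (gradient g) (ball 0 θ) :=
  (InnerProductSpace.toDual ℝ (E m)).symm.continuous.comp_continuousOn
    (hg.continuousOn_fderiv_of_isOpen isOpen_ball (by norm_num))

lemma hasFDerivAt_of_contDiffOn_ball (hg : ContDiffOn ℝ 2 g (ball 0 θ)) {y : E m} (hy : ‖y‖ < θ) :
    HasFDerivAt g (fderiv ℝ g y) y :=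
  ((hg.contDiffAt (isOpen_ball.mem_nhds (by simpa using hy))).differentiableAt
    (by norm_num)).hasFDerivAt

lemma continuousOn_comp_gradient (hg : ContDiffOn ℝ 2 g (ball 0 θ)) (hu : ContinuousOn u U)
    (hθ : ∀ x ∈ U, ‖u x‖ < θ) : ContinuousOn (fun x => gradient g (u x)) U :=
  (continuousOn_gradient hg).comp hu fun x hx => by simpa using hθ x hx

lemma continuousOn_comp_of_contDiffOn (hg : ContDiffOn ℝ 2 g (ball 0 θ)) (hu : ContinuousOn u U)
    (hθ : ∀ x ∈ U, ‖u x‖ < θ) : ContinuousOn (fun x => g (u x)) U :=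
  hg.continuousOn.comp hu fun x hx => by simpa using hθ x hx

/-- The direction `y/|y|` jumps at `0`, so continuity is not available and measurability is
assembled factor by factor. -/
lemma aestronglyMeasurable_rhs (hg : ContDiffOn ℝ 2 g (ball 0 θ)) (hu : ContinuousOn u U)
    (hθ : ∀ x ∈ U, ‖u x‖ < θ) (hU : MeasurableSet U) :
    AEStronglyMeasurable (fun x => rhs g (u x)) (volume.restrict U) := by
  have h1 := (continuousOn_comp_of_contDiffOn hg hu hθ).aestronglyMeasurable hU (μ := volume)
  have h2 := (continuousOn_comp_gradient hg hu hθ).aestronglyMeasurable hU (μ := volume)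
  have h3 := hu.aestronglyMeasurable hU (μ := volume)
  have h4 : AEStronglyMeasurable (fun x => ‖u x‖⁻¹) (volume.restrict U) :=
    (h3.norm.aemeasurable.inv).aestronglyMeasurable
  exact (h1.smul (h4.smul h3)).add (h3.norm.smul h2)

lemma norm_rhs_le (y : E m) : ‖rhs g y‖ ≤ |g y| + ‖y‖ * ‖gradient g y‖ := by
  refine (norm_add_le _ _).trans (add_le_add ?_ ?_)
  · rw [norm_smul, norm_smul, norm_inv, norm_norm, Real.norm_eq_abs]
    exact mul_le_of_le_one_right (abs_nonneg _) (inv_mul_le_one)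
  · rw [norm_smul, norm_norm]

lemma exists_norm_rhs_le (hg : ContDiffOn ℝ 2 g (ball 0 θ)) (hu : ContinuousOn u K)
    (hθ : ∀ x ∈ K, ‖u x‖ < θ) (hK : IsCompact K) : ∃ N, ∀ x ∈ K, ‖rhs g (u x)‖ ≤ N := by
  have h : ContinuousOn (fun x => |g (u x)| + ‖u x‖ * ‖gradient g (u x)‖) K :=
    (continuousOn_comp_of_contDiffOn hg hu hθ).abs.add
      (hu.norm.mul (continuousOn_comp_gradient hg hu hθ).norm)
  obtain ⟨N, hN⟩ := hK.exists_bound_of_continuousOn h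
  exact ⟨N, fun x hx => (norm_rhs_le _).trans ((le_abs_self _).trans (hN x hx))⟩

end Gradient

/-! ### Cauchy property of gradients. -/

section Regularity

variable {n : ℕ} {F : Type*} [NormedAddCommGroup F] [InnerProductSpace ℝ F]

lemma norm_le_sum_norm_basisVec (L : E n →L[ℝ] F) : ‖L‖ ≤ ∑ i, ‖L (basisVec i)‖ := by
  refine L.opNorm_le_bound (Finset.sum_nonneg fun _ _ => norm_nonneg _) fun y => ?_
  have hy : y = ∑ i, y i • basisVec i := by
    ext j
    simp [Pi.single_apply]
  calc ‖L y‖ = ‖∑ i, y i • L (basisVec i)‖ := by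
        conv_lhs => rw [hy]
        simp
    _ ≤ ∑ i, ‖y i • L (basisVec i)‖ := norm_sum_le _ _
    _ ≤ ∑ i, ‖L (basisVec i)‖ * ‖y‖ := by
        refine Finset.sum_le_sum fun i _ => ?_
        rw [norm_smul, mul_comm]
        exact mul_le_mul_of_nonneg_left (PiLp.norm_apply_le y i) (norm_nonneg _)
    _ = _ := by rw [Finset.sum_mul]

lemma vpartial_sub {v w : E n → F} (hv : Differentiable ℝ v) (hw : Differentiable ℝ w)
    (i : Fin n) : vpartial i (fun x => v x - w x) = fun x => vpartial i v x - vpartial i w x := by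
  ext1 x
  simp [vpartial, fderiv_fun_sub (hv x) (hw x)]

lemma lap_sub {v w : E n → F} (hv : ContDiff ℝ 2 v) (hw : ContDiff ℝ 2 w) (x : E n) :
    lap (fun x => v x - w x) x = lap v x - lap w x := by
  have h1 : ∀ {f : E n → F} (_ : ContDiff ℝ 2 f) j, Differentiable ℝ (vpartial j f) :=
    fun hf j => (contDiff_vpartial (k := 1) hf (by norm_num) j).differentiable (by norm_num)
  simp only [lap, ← Finset.sum_sub_distrib]
  refine Finset.sum_congr rfl fun i _ => ?_
  rw [vpartial_sub (hv.differentiable (by norm_num)) (hw.differentiable (by norm_num)),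
    vpartial_sub (h1 hv i) (h1 hw i)]

/-- A uniformly convergent sequence with bounded Laplacians has locally uniformly Cauchy
gradients. -/
lemma uniformCauchySeqOn_fderiv {v : ℕ → E n → F} {u : E n → F} {x₀ : E n} {R₁ R₂ N : ℝ}
    (hv : ∀ k, ContDiff ℝ 2 (v k)) (hconv : TendstoUniformlyOn v u atTop (ball x₀ R₁))
    (hlap : ∀ k, ∀ x ∈ ball x₀ R₁, ‖lap (v k) x‖ ≤ N) (hR : R₂ < R₁) :
    UniformCauchySeqOn (fun k => fderiv ℝ (v k)) atTop (ball x₀ R₂) := by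
  have hN' : ∀ k, ∀ x ∈ ball x₀ R₁, ‖lap (v k) x‖ ≤ |N| := fun k x hx =>
    (hlap k x hx).trans (le_abs_self N)
  rw [Metric.uniformCauchySeqOn_iff]
  intro η hη
  -- The scale `d` is fixed first, to make the Laplacian term small; differences have Laplacian at
  -- most `2|N|`, whence `|N| d`. Only then is the sup-distance `M` chosen, depending on `d`.
  obtain ⟨d, hd, hd1, hd2⟩ : ∃ d : ℝ, 0 < d ∧ n * d < R₁ - R₂ ∧ n * (|N| * d) < η / 2 := by
    have h1 : Tendsto (fun d : ℝ => n * d) (𝓝[>] 0) (𝓝 0) := by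
      have : Continuous fun d : ℝ => n * d := by fun_prop
      simpa using (this.tendsto 0).mono_left nhdsWithin_le_nhds
    have h2 : Tendsto (fun d : ℝ => n * (|N| * d)) (𝓝[>] 0) (𝓝 0) := by
      have : Continuous fun d : ℝ => n * (|N| * d) := by fun_prop
      simpa using (this.tendsto 0).mono_left nhdsWithin_le_nhds
    obtain ⟨d, hd⟩ := ((eventually_mem_nhdsWithin (a := (0:ℝ)) (s := Ioi 0)).and
      ((h1.eventually (gt_mem_nhds (sub_pos.2 hR))).and
        (h2.eventually (gt_mem_nhds (half_pos hη))))).exists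
    exact ⟨d, hd.1, hd.2.1, hd.2.2⟩
  obtain ⟨M, hM, hM1⟩ : ∃ M : ℝ, 0 < M ∧ n * (n * M / d) < η / 2 := by
    have h2 : Tendsto (fun M : ℝ => n * (n * M / d)) (𝓝[>] 0) (𝓝 0) := by
      have : Continuous fun M : ℝ => n * (n * M / d) := by fun_prop
      simpa using (this.tendsto 0).mono_left nhdsWithin_le_nhds
    obtain ⟨d, hd⟩ := ((eventually_mem_nhdsWithin (a := (0:ℝ)) (s := Ioi 0)).and
        (h2.eventually (gt_mem_nhds (half_pos hη)))).exists
    exact ⟨d, hd.1, hd.2⟩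
  obtain ⟨k₀, hk₀⟩ := Metric.uniformCauchySeqOn_iff.1 hconv.uniformCauchySeqOn M hM
  refine ⟨k₀, fun k hk l hl x hx => ?_⟩
  have hsub : closedBall x (n * d) ⊆ ball x₀ R₁ := by
    refine closedBall_subset_ball' ?_
    have := mem_ball.1 hx
    linarith
  have hdif : ∀ k, Differentiable ℝ (v k) := fun k => (hv k).differentiable (by norm_num)
  have hpart : ∀ i, ‖vpartial i (v k) x - vpartial i (v l) x‖ ≤ n * M / d + |N| * d := by
    intro i
    have := norm_vpartial_le_of_bounds (v := fun x => v k x - v l x) ((hv k).sub (hv l)) x i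
      (M := M) (N := 2 * |N|) hd
      (fun z hz => by rw [← dist_eq_norm]; exact (hk₀ k hk l hl z (hsub hz)).le)
      (fun z hz => by
        rw [lap_sub (hv k) (hv l)]
        refine (norm_sub_le _ _).trans ?_
        linarith [hN' k z (hsub hz), hN' l z (hsub hz)])
    rw [vpartial_sub (hdif k) (hdif l)] at this
    linarith
  rw [dist_eq_norm]
  calc _ ≤ ∑ i, ‖(fderiv ℝ (v k) x - fderiv ℝ (v l) x) (basisVec i)‖ :=
        norm_le_sum_norm_basisVec _
    _ ≤ ∑ _i : Fin n, (n * M / d + |N| * d) := Finset.sum_le_sum fun i _ => hpart i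
    _ = n * (n * M / d) + n * (|N| * d) := by simp
    _ < η := by linarith

end Regularity

/-! ### `C¹` regularity and smooth approximation of weak solutions. -/

section Approximation

variable {n m : ℕ}

/-- A weak solution is continuously differentiable, and is approximated by smooth maps. -/
theorem IsSolution.exists_approximation {g : E m → ℝ} {θ : ℝ} (hg : ContDiffOn ℝ 2 g (ball 0 θ))
    {x₀ : E n} {R : ℝ} {u : E n → E m} {G : Fin n → E n → E m}
    (hu : IsSolution g (ball x₀ R) u G) (hθ : ∀ x ∈ ball x₀ R, ‖u x‖ < θ) {R' : ℝ} (hR : R' < R) :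
    ∃ (v : ℕ → E n → E m) (C : ℝ),
      (∀ k, ContDiff ℝ ∞ (v k)) ∧
      (∀ x ∈ ball x₀ R', HasFDerivAt u (fderiv ℝ u x) x) ∧
      ContinuousOn (fderiv ℝ u) (ball x₀ R') ∧
      (∀ x ∈ ball x₀ R', Tendsto (fun k => v k x) atTop (𝓝 (u x))) ∧
      (∀ x ∈ ball x₀ R', Tendsto (fun k => fderiv ℝ (v k) x) atTop (𝓝 (fderiv ℝ u x))) ∧
      (∀ k, ∀ x ∈ ball x₀ R', ‖v k x‖ ≤ C) ∧
      (∀ k, ∀ x ∈ ball x₀ R', ‖fderiv ℝ (v k) x‖ ≤ C) ∧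
      (∀ k, ∀ x ∈ ball x₀ R', ‖lap (v k) x‖ ≤ C) ∧
      (∀ᵐ x ∂(volume.restrict (ball x₀ R')),
        Tendsto (fun k => lap (v k) x) atTop (𝓝 (rhs g (u x)))) ∧
      (∀ i, ∀ᵐ x ∂(volume.restrict (ball x₀ R')), G i x = vpartial i u x) := by
  -- Radii `R' < R₂ < R₁ < R₀ < R`: the data are cut off at `R₀`, kernels of radius at most `R₀ -
  -- R₁` act correctly on `R₁`, gradients converge on `R₂`, and compactness of the closed `R'`-ball
  -- gives bounds.
  obtain ⟨R₂, hR₂, hR₂R⟩ := exists_between hR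
  obtain ⟨R₁, hR₁, hR₁R⟩ := exists_between hR₂R
  obtain ⟨R₀, hR₀, hR₀R⟩ := exists_between hR₁R
  set K := closedBall x₀ R₀ with hKdef
  have hK : IsCompact K := isCompact_closedBall _ _
  have hKU : K ⊆ ball x₀ R := closedBall_subset_ball hR₀R
  set c := R₀ - R₁ with hcdef
  have hc : 0 < c := sub_pos.2 hR₀
  let B : ℕ → ContDiffBump (0 : E n) := fun k =>
    ⟨c / (k + 1) / 2, c / (k + 1), by positivity, half_lt_self (by positivity)⟩
  let ρ : ℕ → E n → ℝ := fun k => (B k).normed volume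
  have hBout : ∀ k, (B k).rOut = c / (k + 1) := fun k => rfl
  have hBle : ∀ k, (B k).rOut ≤ c := fun k => by
    rw [hBout]
    exact div_le_self hc.le (by simp)
  have hBt : Tendsto (fun k => (B k).rOut) atTop (𝓝 0) := by
    simp only [hBout]
    have := (tendsto_one_div_add_atTop_nhds_zero_nat (𝕜 := ℝ)).const_mul c
    simpa [div_eq_mul_inv] using this
  have hρ : ∀ k, ContDiff ℝ ∞ (ρ k) := fun k => (B k).contDiff_normed
  have hρs : ∀ k, tsupport (ρ k) ⊆ closedBall 0 c := fun k => by
    rw [show tsupport (ρ k) = _ from (B k).tsupport_normed_eq]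
    exact closedBall_subset_closedBall (hBle k)
  have hρc : ∀ k, HasCompactSupport (ρ k) := fun k => (B k).hasCompactSupport_normed
  have hcK : ∀ x ∈ ball x₀ R₁, closedBall x c ⊆ K := fun x hx => by
    refine closedBall_subset_closedBall' ?_
    have := mem_ball.1 hx
    linarith
  have huK : ContinuousOn u K := hu.continuousOn.mono hKU
  have hθK : ∀ x ∈ K, ‖u x‖ < θ := fun x hx => hθ x (hKU hx)
  set f : E n → E m := fun x => rhs g (u x) with hf
  obtain ⟨N, hN⟩ := exists_norm_rhs_le hg huK hθK hK
  have hfm : AEStronglyMeasurable (K.indicator f) := by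
    rw [aestronglyMeasurable_indicator_iff hK.measurableSet]
    exact aestronglyMeasurable_rhs hg huK hθK hK.measurableSet
  have hfi : Integrable (K.indicator f) := by
    rw [integrable_indicator_iff hK.measurableSet]
    have : Fact (volume K < ⊤) := ⟨hK.measure_lt_top⟩
    exact Integrable.of_bound (aestronglyMeasurable_rhs hg huK hθK hK.measurableSet) N
      ((ae_restrict_iff' hK.measurableSet).2 (Eventually.of_forall hN))
  have hui : Integrable (K.indicator u) :=
    (integrable_indicator_iff hK.measurableSet).2 (hu.sobolev.integrableOn hKU hK)
  have hGi : ∀ i, Integrable (K.indicator (G i)) := fun i =>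
    (integrable_indicator_iff hK.measurableSet).2 (hu.sobolev.integrableOn_grad hKU hK i)
  let w : ℕ → E n → E m := fun k => (ρ k ⋆[lsmul ℝ ℝ] K.indicator u)
  have hw : ∀ k, ContDiff ℝ ∞ (w k) := fun k =>
    (hρc k).contDiff_convolution_left _ (hρ k) hui.locallyIntegrable
  have hwlap : ∀ k, ∀ x ∈ ball x₀ R₁, lap (w k) x = (ρ k ⋆[lsmul ℝ ℝ] K.indicator f) x :=
    fun k x hx => hu.lap_mollify measurableSet_ball hKU hK (hρ k) (hρs k) (hcK x hx)
  have hwpart : ∀ k, ∀ x ∈ ball x₀ R₁, ∀ i,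
      vpartial i (w k) x = (ρ k ⋆[lsmul ℝ ℝ] K.indicator (G i)) x :=
    fun k x hx i => hu.sobolev.vpartial_mollify measurableSet_ball hKU hK (hρ k) (hρs k)
      (hcK x hx) i
  have hlapN : ∀ k, ∀ x ∈ ball x₀ R₁, ‖lap (w k) x‖ ≤ 3 * |N| := by
    intro k x hx
    have hb : ∀ y, ‖K.indicator f y‖ ≤ |N| := fun y => by
      by_cases hy : y ∈ K
      · simpa [hy] using (hN y hy).trans (le_abs_self N)
      · simp [hy]
    -- The cut-off right-hand side oscillates by at most `2|N|` and has size at most `|N|`, hence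
    -- the constant `3|N|`.
    have := (B k).dist_normed_convolution_le (x₀ := x) (ε := 2 * |N|) hfm (fun y _ => by
      rw [dist_eq_norm]
      exact (norm_sub_le _ _).trans (by linarith [hb y, hb x]))
    rw [hwlap k x hx]
    have h2 := norm_le_norm_add_norm_sub' ((ρ k ⋆[lsmul ℝ ℝ] K.indicator f) x) (K.indicator f x)
    rw [dist_eq_norm] at this
    linarith [hb x]
  have hunif : TendstoUniformlyOn w u atTop (ball x₀ R₁) := by
    rw [Metric.tendstoUniformlyOn_iff]
    intro η hη
    obtain ⟨δ, hδ, hδu⟩ := Metric.uniformContinuousOn_iff.1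
      (hK.uniformContinuousOn_of_continuous huK) (η / 2) (half_pos hη)
    filter_upwards [hBt.eventually (gt_mem_nhds hδ)] with k hk x hx
    have hxK : x ∈ K := hcK x hx (mem_closedBall_self hc.le)
    have := (B k).dist_normed_convolution_le (x₀ := x) (ε := η / 2) hui.aestronglyMeasurable
      (fun y hy => by
        have hyK : y ∈ K := hcK x hx (ball_subset_closedBall (ball_subset_ball (hBle k) hy))
        rw [indicator_of_mem hyK, indicator_of_mem hxK]
        exact (hδu y hyK x hxK ((mem_ball.1 hy).trans hk)).le)
    rw [indicator_of_mem hxK] at this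
    rw [dist_comm]
    exact this.trans_lt (half_lt_self hη)
  have hcauchy := uniformCauchySeqOn_fderiv (fun k => (hw k).of_le (by norm_cast)) hunif hlapN hR₁
  have hlim : ∀ x ∈ ball x₀ R₂, ∃ L, Tendsto (fun k => fderiv ℝ (w k) x) atTop (𝓝 L) :=
    fun x hx => cauchySeq_tendsto_of_complete (hcauchy.cauchySeq hx)
  choose! H hH using hlim
  have hHu : TendstoUniformlyOn (fun k => fderiv ℝ (w k)) H atTop (ball x₀ R₂) :=
    hcauchy.tendstoUniformlyOn_of_tendsto hH
  have h21 : ball x₀ R₂ ⊆ ball x₀ R₁ := ball_subset_ball hR₁.le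
  have h2 : ball x₀ R' ⊆ ball x₀ R₂ := ball_subset_ball hR₂.le
  have hderiv : ∀ x ∈ ball x₀ R₂, HasFDerivAt u (H x) x := fun x hx =>
    hasFDerivAt_of_tendstoUniformlyOn isOpen_ball hHu
      (fun k y _ => ((hw k).differentiable (by simp) y).hasFDerivAt)
      (fun y hy => hunif.tendsto_at (h21 hy)) hx
  have hHeq : ∀ x ∈ ball x₀ R₂, H x = fderiv ℝ u x := fun x hx => (hderiv x hx).fderiv.symm
  have hHc : ContinuousOn H (ball x₀ R₂) :=
    hHu.continuousOn (Frequently.of_forall fun k =>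
      ((hw k).continuous_fderiv (by simp)).continuousOn)
  have h'2 : closedBall x₀ R' ⊆ ball x₀ R₂ := closedBall_subset_ball hR₂
  obtain ⟨C₁, hC₁⟩ := (isCompact_closedBall x₀ R').exists_bound_of_continuousOn (hHc.mono h'2)
  obtain ⟨C₂, hC₂⟩ := (isCompact_closedBall x₀ R').exists_bound_of_continuousOn
    (huK.mono ((h'2.trans h21).trans fun x hx => hcK x hx (mem_closedBall_self hc.le)))
  -- The approximants are within `1` of their limits only from `k₀` on; the sequence is shifted by
  -- `k₀` so that the bounds hold for every index.
  obtain ⟨k₀, hk₀⟩ := eventually_atTop.1 ((Metric.tendstoUniformlyOn_iff.1 hunif 1 one_pos).and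
    (Metric.tendstoUniformlyOn_iff.1 hHu 1 one_pos))
  have hle1 : C₂ + 1 ≤ max (max (C₂ + 1) (C₁ + 1)) (3 * |N|) :=
    (le_max_left _ _).trans (le_max_left _ _)
  have hle2 : C₁ + 1 ≤ max (max (C₂ + 1) (C₁ + 1)) (3 * |N|) :=
    (le_max_right _ _).trans (le_max_left _ _)
  have hadd : Tendsto (fun k : ℕ => k + k₀) atTop atTop := tendsto_add_atTop_nat k₀
  have hKR : ∀ x ∈ ball x₀ R', x ∈ K := fun x hx =>
    hcK x (h21 (h2 hx)) (mem_closedBall_self hc.le)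
  have hratio : ∀ᶠ k in (atTop : Filter ℕ), (B k).rOut ≤ 2 * (B k).rIn :=
    Eventually.of_forall fun k => by
      change c / (k + 1) ≤ 2 * (c / (k + 1) / 2)
      linarith
  refine ⟨fun k => w (k + k₀), max (max (C₂ + 1) (C₁ + 1)) (3 * |N|), fun k => hw _, ?_, ?_, ?_,
    ?_, ?_, ?_, ?_, ?_, ?_⟩
  · exact fun x hx => hHeq x (h2 hx) ▸ hderiv x (h2 hx)
  · exact (hHc.mono h2).congr fun x hx => (hHeq x (h2 hx)).symm
  · exact fun x hx => (hunif.tendsto_at (h21 (h2 hx))).comp hadd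
  · exact fun x hx => hHeq x (h2 hx) ▸ (hH x (h2 hx)).comp hadd
  · intro k x hx
    refine le_trans ?_ hle1
    have := (hk₀ (k + k₀) (by simp)).1 x (h21 (h2 hx))
    rw [dist_comm, dist_eq_norm] at this
    have h3 := norm_le_norm_add_norm_sub' (w (k + k₀) x) (u x)
    linarith [hC₂ x (ball_subset_closedBall hx)]
  · intro k x hx
    refine le_trans ?_ hle2
    have := (hk₀ (k + k₀) (by simp)).2 x (h2 hx)
    rw [dist_comm, dist_eq_norm] at this
    have h3 := norm_le_norm_add_norm_sub' (fderiv ℝ (w (k + k₀)) x) (H x)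
    linarith [hC₁ x (ball_subset_closedBall hx)]
  · exact fun k x hx => (hlapN _ x (h21 (h2 hx))).trans (le_max_right _ _)
  · rw [ae_restrict_iff' measurableSet_ball]
    filter_upwards [ContDiffBump.ae_convolution_tendsto_right_of_locallyIntegrable (K := 2) hBt
      hratio hfi.locallyIntegrable] with x hx hxR
    rw [indicator_of_mem (hKR x hxR)] at hx
    exact (hx.congr fun k => (hwlap k x (h21 (h2 hxR))).symm).comp hadd
  · intro i
    rw [ae_restrict_iff' measurableSet_ball]
    -- At almost every point `∂ᵢ w_k` tends to the weak derivative, by Lebesgue differentiation, and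
    -- everywhere in the ball to the classical one, by uniform convergence.
    filter_upwards [ContDiffBump.ae_convolution_tendsto_right_of_locallyIntegrable (K := 2) hBt
      hratio (hGi i).locallyIntegrable] with x hx hxR
    rw [indicator_of_mem (hKR x hxR)] at hx
    have h4 := hx.congr fun k => (hwpart k x (h21 (h2 hxR)) i).symm
    have h5 : Tendsto (fun k => vpartial i (w k) x) atTop (𝓝 (H x (basisVec i))) :=
      ((ContinuousLinearMap.apply ℝ (E m) (basisVec i)).continuous.tendsto _).comp
        (hH x (h2 hxR))
    rw [hHeq x (h2 hxR)] at h5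
    exact tendsto_nhds_unique h4 h5

end Approximation

/-! ### Surface measure and polar coordinates. -/

section Sphere

variable {n : ℕ} {F : Type*} [NormedAddCommGroup F] [NormedSpace ℝ F]

lemma measurableEmbedding_sphere (x₀ : E n) {r : ℝ} (hr : 0 < r) :
    MeasurableEmbedding (fun ξ : sphere (0 : E n) 1 => x₀ + r • (ξ : E n)) := by
  refine (Continuous.isClosedEmbedding (by fun_prop) fun ξ η h => ?_).measurableEmbedding
  have h1 : r • (ξ : E n) = r • (η : E n) := add_left_cancel h
  exact Subtype.ext ((smul_right_injective _ hr.ne') h1)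

lemma integral_surface (x₀ : E n) {r : ℝ} (hr : 0 < r) (f : E n → F) :
    ∫ x, f x ∂(surface x₀ r)
      = r ^ (n - 1) • ∫ ξ : sphere (0 : E n) 1, f (x₀ + r • (ξ : E n))
          ∂((volume : Measure (E n)).toSphere) := by
  rw [surface, integral_smul_measure, (measurableEmbedding_sphere x₀ hr).integral_map,
    ENNReal.toReal_ofReal (by positivity)]

instance isFiniteMeasure_surface (x₀ : E n) (r : ℝ) : IsFiniteMeasure (surface x₀ r) := by
  unfold surface
  refine ⟨?_⟩
  rw [Measure.smul_apply, smul_eq_mul]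
  exact ENNReal.mul_lt_top ENNReal.ofReal_lt_top (measure_lt_top _ _)

lemma ae_surface_mem (x₀ : E n) {r : ℝ} (hr : 0 ≤ r) :
    ∀ᵐ x ∂(surface x₀ r), x ∈ sphere x₀ r := by
  unfold surface
  refine Measure.ae_smul_measure ?_ _
  refine (ae_map_iff (p := (· ∈ sphere x₀ r)) (by fun_prop) isClosed_sphere.measurableSet).2
    (Eventually.of_forall fun ξ => ?_)
  have : ‖(ξ : E n)‖ = 1 := by simp
  simp [norm_smul, this, abs_of_nonneg hr]

lemma integral_surface_rescale (x₀ : E n) {r : ℝ} (hr : 0 < r) (f : E n → F) :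
    ∫ x, f x ∂(surface x₀ r) = r ^ (n - 1) • ∫ x, f (x₀ + r • x) ∂(surface 0 1) := by
  rw [integral_surface x₀ hr, integral_surface 0 one_pos]
  simp

/-- Integration in polar coordinates. -/
lemma integral_polar (hn : 0 < n) {f : E n → F} (hf : Integrable f) :
    ∫ x, f x = ∫ r in Ioi (0 : ℝ), ∫ x, f x ∂(surface 0 r) := by
  have : Nonempty (Fin n) := ⟨⟨0, hn⟩⟩
  have hmp := (volume : Measure (E n)).measurePreserving_homeomorphUnitSphereProd
  have hemb := (homeomorphUnitSphereProd (E n)).measurableEmbedding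
  let φ : sphere (0 : E n) 1 × Ioi (0 : ℝ) → F := fun p => f (p.2.1 • p.1.1)
  have hφ : ∀ x : ({0}ᶜ : Set (E n)), φ (homeomorphUnitSphereProd (E n) x) = f x := by
    intro x
    have : ‖(x : E n)‖ ≠ 0 := norm_ne_zero_iff.2 x.2
    simp [φ, smul_smul, mul_inv_cancel₀ this]
  have hint : Integrable φ ((volume : Measure (E n)).toSphere.prod
      (Measure.volumeIoiPow (Module.finrank ℝ (E n) - 1))) := by
    rw [← hmp.integrable_comp_emb hemb]
    have : φ ∘ (homeomorphUnitSphereProd (E n)) = fun x : ({0}ᶜ : Set (E n)) => f x := funext hφ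
    rw [this]
    exact (integrableOn_iff_comap_subtypeVal (measurableSet_singleton _).compl).1 hf.integrableOn
  calc ∫ x, f x = ∫ x : ({0}ᶜ : Set (E n)), f x ∂(Measure.comap Subtype.val volume) := by
        rw [integral_subtype_comap (measurableSet_singleton _).compl fun x ↦ f x,
          restrict_compl_singleton]
    _ = ∫ p, φ p ∂((volume : Measure (E n)).toSphere.prod
          (Measure.volumeIoiPow (Module.finrank ℝ (E n) - 1))) := by
        rw [← hmp.integral_comp hemb]
        simp only [hφ]
    _ = ∫ r : Ioi (0 : ℝ), ∫ ξ, φ (ξ, r) ∂((volume : Measure (E n)).toSphere)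
          ∂(Measure.volumeIoiPow (Module.finrank ℝ (E n) - 1)) := integral_prod_symm _ hint
    _ = _ := by
        simp only [Measure.volumeIoiPow, ENNReal.ofReal]
        rw [integral_withDensity_eq_integral_smul
            ((measurable_subtype_coe.pow_const _).real_toNNReal),
          integral_subtype_comap measurableSet_Ioi fun a ↦
            Real.toNNReal (a ^ (Module.finrank ℝ (E n) - 1)) •
              ∫ ξ : sphere (0 : E n) 1, f (a • (ξ : E n)) ∂((volume : Measure (E n)).toSphere)]
        refine setIntegral_congr_fun measurableSet_Ioi fun r hr => ?_
        simp only [integral_surface 0 (mem_Ioi.1 hr), NNReal.smul_def, zero_add]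
        rw [Real.coe_toNNReal _ (pow_nonneg (mem_Ioi.1 hr).le _)]
        simp

end Sphere

/-! ### Radial cutoffs concentrating on the unit sphere. -/

section Cutoff

/-- A smooth function equal to `1` for `t ≤ 1 - 1 / k` and to `0` for `1 ≤ t`. -/
noncomputable def cutoff (k : ℕ) (t : ℝ) : ℝ := Real.smoothTransition (k * (1 - t))

lemma contDiff_cutoff (k : ℕ) : ContDiff ℝ ∞ (cutoff k) :=
  Real.smoothTransition.contDiff.comp (by fun_prop)

lemma antitone_cutoff (k : ℕ) : Antitone (cutoff k) := fun s t h =>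
  Real.smoothTransition.monotone (mul_le_mul_of_nonneg_left (by linarith) (Nat.cast_nonneg k))

lemma cutoff_of_one_le (k : ℕ) {t : ℝ} (ht : 1 ≤ t) : cutoff k t = 0 :=
  Real.smoothTransition.zero_of_nonpos
    (mul_nonpos_of_nonneg_of_nonpos (Nat.cast_nonneg k) (by linarith))

lemma cutoff_of_le (k : ℕ) {t : ℝ} (ht : 1 ≤ k * (1 - t)) : cutoff k t = 1 :=
  Real.smoothTransition.one_of_one_le ht

lemma deriv_cutoff_of_one_lt (k : ℕ) {t : ℝ} (ht : 1 < t) : deriv (cutoff k) t = 0 := by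
  have : cutoff k =ᶠ[𝓝 t] fun _ => 0 := by
    filter_upwards [lt_mem_nhds ht] with s hs using cutoff_of_one_le k hs.le
  rw [this.deriv_eq, deriv_const]

lemma deriv_cutoff_of_lt (k : ℕ) {t : ℝ} (ht : 1 < k * (1 - t)) : deriv (cutoff k) t = 0 := by
  have hc : Continuous fun s : ℝ => k * (1 - s) := by fun_prop
  have : cutoff k =ᶠ[𝓝 t] fun _ => 1 := by
    filter_upwards [hc.continuousAt.eventually (lt_mem_nhds ht)] with s hs
      using cutoff_of_le k hs.le
  rw [this.deriv_eq, deriv_const]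

/-- Concentration at `1` of the radial derivative of the cutoff. -/
lemma tendsto_integral_deriv_cutoff {q : ℝ → ℝ} (hq : Continuous q) :
    Tendsto (fun k : ℕ => ∫ r in Ioi (0 : ℝ), -(2 * r * deriv (cutoff k) (r ^ 2)) * q r) atTop
      (𝓝 (q 1)) := by
  -- On `r > 0` the weights form an approximate identity at `1`: being derivatives of `-cutoff k
  -- (r²)`, they are nonnegative, have mass `1` for `k > 0`, and vanish unless `1 - 1/k ≤ r² ≤ 1`.
  let w : ℕ → ℝ → ℝ := fun k r => -(2 * r * deriv (cutoff k) (r ^ 2))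
  have hcont : ∀ k, Continuous (w k) := fun k => by
    have := (contDiff_cutoff k).continuous_deriv (by simp)
    fun_prop
  have hcs : ∀ k, HasCompactSupport (w k) := fun k => by
    refine HasCompactSupport.intro (isCompact_Icc (a := -1) (b := (1 : ℝ))) fun r hr => ?_
    have : 1 < r ^ 2 := by
      rw [one_lt_sq_iff_one_lt_abs]
      by_contra! h
      exact hr (abs_le.1 h)
    simp [w, deriv_cutoff_of_one_lt k this]
  have hnn : ∀ k, ∀ r, 0 < r → 0 ≤ w k r := fun k r hr => by
    have : deriv (cutoff k) (r ^ 2) ≤ 0 := (antitone_cutoff k).deriv_nonpos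
    simp only [w]
    nlinarith
  have hmass : ∀ k : ℕ, 0 < k → ∫ r in Ioi (0 : ℝ), w k r = 1 := by
    intro k hk
    have hd : ∀ r : ℝ, HasDerivAt (fun r => - cutoff k (r ^ 2)) (w k r) r := by
      intro r
      have h1 : HasDerivAt (cutoff k) (deriv (cutoff k) (r ^ 2)) (r ^ 2) :=
        ((contDiff_cutoff k).differentiable (by simp) _).hasDerivAt
      have h2 := (HasDerivAt.comp (h := fun r : ℝ => r ^ 2) r h1 (hasDerivAt_pow 2 r)).neg
      refine h2.congr_deriv ?_
      simp [w]
      ring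
    have hlim : Tendsto (fun r : ℝ => - cutoff k (r ^ 2)) atTop (𝓝 0) := by
      refine tendsto_const_nhds.congr' ?_
      filter_upwards [eventually_ge_atTop (1 : ℝ)] with r hr
      rw [cutoff_of_one_le k (by nlinarith)]
      simp
    have := integral_Ioi_of_hasDerivAt_of_tendsto' (a := 0) (fun r _ => hd r)
      ((hcont k).integrable_of_hasCompactSupport (hcs k)).integrableOn hlim
    rw [this, zero_pow two_ne_zero, cutoff_of_le k]
    · simp
    · simpa using Nat.one_le_iff_ne_zero.2 hk.ne'
  rw [Metric.tendsto_atTop]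
  intro η hη
  obtain ⟨δ, hδ, hδq⟩ := Metric.continuousAt_iff.1 (hq.continuousAt (x := 1)) (η / 2) (half_pos hη)
  obtain ⟨k₀, hk₀⟩ := exists_nat_gt (1 / δ)
  refine ⟨k₀ + 1, fun k hk => ?_⟩
  have hkpos : 0 < k := by omega
  have hkδ : 1 < k * δ := by
    have : (k₀ : ℝ) < k := by exact_mod_cast (by omega : k₀ < k)
    rw [div_lt_iff₀ hδ] at hk₀
    nlinarith
  have hint : ∀ q' : ℝ → ℝ, Continuous q' → IntegrableOn (fun r => w k r * q' r) (Ioi 0) :=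
    fun q' hq' => (((hcont k).mul hq').integrable_of_hasCompactSupport
      ((hcs k).mul_right)).integrableOn
  have hsub : (∫ r in Ioi (0 : ℝ), w k r * q r) - q 1
      = ∫ r in Ioi (0 : ℝ), w k r * (q r - q 1) := by
    simp only [mul_sub]
    rw [integral_sub (hint q hq) (hint _ continuous_const), integral_mul_const, hmass k hkpos,
      one_mul]
  rw [Real.dist_eq, hsub, ← Real.norm_eq_abs]
  have hle : ‖∫ r in Ioi (0 : ℝ), w k r * (q r - q 1)‖
      ≤ ∫ r in Ioi (0 : ℝ), w k r * (η / 2) := by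
    refine norm_integral_le_of_norm_le (hint _ continuous_const) ?_
    rw [ae_restrict_iff' measurableSet_Ioi]
    refine Eventually.of_forall fun r hr => ?_
    have hr0 : 0 < r := hr
    rw [norm_mul, Real.norm_of_nonneg (hnn k r hr0)]
    by_cases h0 : w k r = 0
    · simp [h0]
    refine mul_le_mul_of_nonneg_left ?_ (hnn k r hr0)
    have hd0 : deriv (cutoff k) (r ^ 2) ≠ 0 := fun h => h0 (by simp [w, h])
    have h1 : r ^ 2 ≤ 1 := by
      by_contra! h
      exact hd0 (deriv_cutoff_of_one_lt k h)
    have h2 : k * (1 - r ^ 2) ≤ 1 := by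
      by_contra! h
      exact hd0 (deriv_cutoff_of_lt k h)
    have hr1 : r ≤ 1 := by nlinarith
    have : 1 - r ≤ 1 - r ^ 2 := by nlinarith
    have hk0 : (0 : ℝ) < k := by exact_mod_cast hkpos
    have h3 : 1 - r < δ := by
      have : k * (1 - r) < k * δ := by nlinarith
      exact lt_of_mul_lt_mul_left this hk0.le
    have := hδq (x := r) (by rw [Real.dist_eq, abs_lt]; constructor <;> linarith)
    exact (le_of_lt (by simpa [Real.dist_eq] using this))
  rw [integral_mul_const, hmass k hkpos] at hle
  linarith

end Cutoff

/-! ### Divergence theorem on the unit ball. -/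

section Divergence

variable {n : ℕ}

/-- The divergence theorem on the unit ball. -/
theorem integral_vpartial_ball {h : E n → ℝ} (hh : ContDiff ℝ 1 h) (i : Fin n) :
    ∫ x in ball (0 : E n) 1, vpartial i h x = ∫ x, x i * h x ∂(surface 0 1) := by
  have hn : 0 < n := i.pos
  -- Integration by parts on the whole space against `ζ k` has no boundary term; the sphere
  -- reappears as the place where `∇ζ k` concentrates. Using `‖x‖²` keeps `ζ k` smooth at the
  -- origin.
  let ζ : ℕ → E n → ℝ := fun k x => cutoff k (‖x‖ ^ 2)
  have hζ : ∀ k, ContDiff ℝ ∞ (ζ k) := fun k => (contDiff_cutoff k).comp (contDiff_norm_sq ℝ)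
  have hζs : ∀ k, HasCompactSupport (ζ k) := fun k => by
    refine HasCompactSupport.intro (isCompact_closedBall (0 : E n) 1) fun x hx => ?_
    have : 1 < ‖x‖ := by simpa using hx
    exact cutoff_of_one_le k (by nlinarith)
  have hζd : ∀ k x, vpartial i (ζ k) x = 2 * x i * deriv (cutoff k) (‖x‖ ^ 2) := by
    intro k x
    have h1 : HasDerivAt (cutoff k) (deriv (cutoff k) (‖x‖ ^ 2)) (‖x‖ ^ 2) :=
      ((contDiff_cutoff k).differentiable (by simp) _).hasDerivAt
    have h2 := h1.comp_hasFDerivAt x (hasStrictFDerivAt_norm_sq x).hasFDerivAt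
    have h3 : HasFDerivAt (ζ k) _ x := h2
    rw [vpartial, h3.fderiv]
    simp [EuclideanSpace.inner_single_right]
    ring
  have hζc : ∀ k, Continuous (vpartial i (ζ k)) := fun k =>
    (contDiff_vpartial (k := 0) (hζ k) (by simp) i).continuous
  have hhc : Continuous (vpartial i h) :=
    (contDiff_vpartial (k := 0) hh (by simp) i).continuous
  have hζds : ∀ k, HasCompactSupport (vpartial i (ζ k)) := fun k =>
    (hζs k).fderiv_apply (𝕜 := ℝ) _
  have hparts : ∀ k, ∫ x, ζ k x * vpartial i h x = - ∫ x, vpartial i (ζ k) x * h x := by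
    intro k
    refine integral_mul_fderiv_eq_neg_fderiv_mul_of_integrable ?_ ?_ ?_ ?_ ?_
    · exact ((hζc k).mul hh.continuous).integrable_of_hasCompactSupport (hζds k).mul_right
    · exact ((hζ k).continuous.mul hhc).integrable_of_hasCompactSupport (hζs k).mul_right
    · exact ((hζ k).continuous.mul hh.continuous).integrable_of_hasCompactSupport
        (hζs k).mul_right
    · exact fun x _ => (hζ k).differentiable (by simp) x
    · exact fun x _ => hh.differentiable (by simp) x
  -- In polar coordinates `∂ᵢ(ζ k) = 2 r ξᵢ (cutoff k)'(r²)`; the remaining factors form `q`, and `q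
  -- 1` is the boundary integral.
  let q : ℝ → ℝ := fun r => r ^ (n - 1) * ∫ ξ : sphere (0 : E n) 1,
    (ξ : E n) i * h (r • (ξ : E n)) ∂((volume : Measure (E n)).toSphere)
  have hq : Continuous q := by
    refine (continuous_pow _).mul ?_
    have hc : Continuous (Function.uncurry fun (r : ℝ) (ξ : sphere (0 : E n) 1) =>
        (ξ : E n) i * h (r • (ξ : E n))) := by
      have := hh.continuous
      simp only [Function.uncurry_def]
      fun_prop
    simpa using continuous_parametric_integral_of_continuous
      (μ := (volume : Measure (E n)).toSphere) hc isCompact_univ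
  have hpolar : ∀ k, - ∫ x, vpartial i (ζ k) x * h x
      = ∫ r in Ioi (0 : ℝ), -(2 * r * deriv (cutoff k) (r ^ 2)) * q r := by
    intro k
    have hint : Integrable (fun x => vpartial i (ζ k) x * h x) :=
      ((hζc k).mul hh.continuous).integrable_of_hasCompactSupport (hζds k).mul_right
    rw [integral_polar hn hint, ← integral_neg]
    refine setIntegral_congr_fun measurableSet_Ioi fun r hr => ?_
    have hr0 : 0 < r := hr
    simp only [q]
    rw [integral_surface 0 hr0, smul_eq_mul, ← integral_const_mul, ← integral_const_mul,
      ← integral_const_mul, ← integral_neg]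
    refine integral_congr_ae (Eventually.of_forall fun ξ => ?_)
    have h1 : ‖(ξ : E n)‖ = 1 := by simp
    simp only [zero_add, hζd, norm_smul, h1, mul_one, Real.norm_eq_abs, sq_abs, PiLp.smul_apply,
      smul_eq_mul]
    ring
  have hlim1 := tendsto_integral_deriv_cutoff hq
  have hlim2 : Tendsto (fun k => ∫ x, ζ k x * vpartial i h x) atTop
      (𝓝 (∫ x, (ball (0 : E n) 1).indicator (vpartial i h) x)) := by
    refine tendsto_integral_of_dominated_convergence
      (fun x => (closedBall (0 : E n) 1).indicator (fun x => ‖vpartial i h x‖) x)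
      (fun k => ((hζ k).continuous.mul hhc).aestronglyMeasurable) ?_ ?_ ?_
    · rw [integrable_indicator_iff isClosed_closedBall.measurableSet]
      exact hhc.norm.continuousOn.integrableOn_compact (isCompact_closedBall _ _)
    · refine fun k => Eventually.of_forall fun x => ?_
      by_cases hx : x ∈ closedBall (0 : E n) 1
      · rw [indicator_of_mem hx, norm_mul]
        refine mul_le_of_le_one_left (norm_nonneg _) ?_
        change ‖Real.smoothTransition _‖ ≤ 1
        rw [Real.norm_of_nonneg (Real.smoothTransition.nonneg _)]
        exact Real.smoothTransition.le_one _
      · have : 1 < ‖x‖ := by simpa using hx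
        rw [indicator_of_notMem hx]
        simp [ζ, cutoff_of_one_le k (t := ‖x‖ ^ 2) (by nlinarith)]
    · refine Eventually.of_forall fun x => ?_
      by_cases hx : x ∈ ball (0 : E n) 1
      · rw [indicator_of_mem hx]
        have hx1 : ‖x‖ < 1 := by simpa using hx
        have hpos : 0 < 1 - ‖x‖ ^ 2 := by nlinarith [norm_nonneg x]
        refine tendsto_const_nhds.congr' ?_
        obtain ⟨k₀, hk₀⟩ := exists_nat_gt (1 / (1 - ‖x‖ ^ 2))
        filter_upwards [eventually_ge_atTop k₀] with k hk
        have : (k₀ : ℝ) ≤ k := by exact_mod_cast hk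
        rw [div_lt_iff₀ hpos] at hk₀
        simp only [ζ]
        rw [cutoff_of_le k (by nlinarith), one_mul]
      · rw [indicator_of_notMem hx]
        have hx1 : 1 ≤ ‖x‖ := by simpa using hx
        refine tendsto_const_nhds.congr fun k => ?_
        simp [ζ, cutoff_of_one_le k (t := ‖x‖ ^ 2) (by nlinarith)]
  rw [integral_indicator measurableSet_ball] at hlim2
  have := tendsto_nhds_unique hlim2 (hlim1.congr fun k => by rw [hparts, hpolar])
  rw [this, integral_surface 0 one_pos]
  simp [q]

end Divergence

/-! ### Parameter integrals over a finite measure carried by a compact set. -/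

section Parametric

variable {n : ℕ} {μ : Measure (E n)} {K : Set (E n)}

lemma aestronglyMeasurable_of_continuousOn (hK : IsCompact K) (hμ : ∀ᵐ x ∂μ, x ∈ K)
    {F : Type*} [NormedAddCommGroup F] {f : E n → F} (hf : ContinuousOn f K) :
    AEStronglyMeasurable f μ := by
  rw [← Measure.restrict_eq_self_of_ae_mem hμ]
  exact hf.aestronglyMeasurable_of_isCompact hK hK.measurableSet

variable [IsFiniteMeasure μ]

lemma integrable_of_continuousOn (hK : IsCompact K) (hμ : ∀ᵐ x ∂μ, x ∈ K)
    {F : Type*} [NormedAddCommGroup F] {f : E n → F} (hf : ContinuousOn f K) :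
    Integrable f μ := by
  obtain ⟨C, hC⟩ := hK.exists_bound_of_continuousOn hf
  exact Integrable.of_bound (aestronglyMeasurable_of_continuousOn hK hμ hf) C
    (hμ.mono fun x hx => hC x hx)

lemma exists_bound_near {Φ : ℝ → E n → ℝ} {a b : ℝ} (hK : IsCompact K)
    (hΦ : ContinuousOn (Function.uncurry Φ) (Ioo a b ×ˢ K)) {s : ℝ} (hs : s ∈ Ioo a b) :
    ∃ C, ∃ V ∈ 𝓝 s, V ⊆ Ioo a b ∧ ∀ t ∈ V, ∀ x ∈ K, ‖Φ t x‖ ≤ C := by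
  obtain ⟨c, hac, hcs⟩ := exists_between hs.1
  obtain ⟨d, hsd, hdb⟩ := exists_between hs.2
  have hsub : Icc c d ⊆ Ioo a b := Icc_subset_Ioo hac hdb
  obtain ⟨C, hC⟩ := (isCompact_Icc.prod hK).exists_bound_of_continuousOn
    (hΦ.mono (prod_mono hsub subset_rfl))
  exact ⟨C, Icc c d, Icc_mem_nhds hcs hsd, hsub, fun t ht x hx => hC (t, x) ⟨ht, hx⟩⟩

lemma continuousOn_slice {Φ : ℝ → E n → ℝ} {I : Set ℝ}
    (hΦ : ContinuousOn (Function.uncurry Φ) (I ×ˢ K)) {s : ℝ} (hs : s ∈ I) :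
    ContinuousOn (Φ s) K :=
  hΦ.comp (f := fun x => (s, x)) (by fun_prop) fun _ hx => ⟨hs, hx⟩

/-- A constant dominates: `Φ'` is bounded on a compact parameter interval times `K`, and `μ` is
finite. With `K` the closed unit ball this serves both for the ball and for its sphere. -/
lemma hasDerivAt_integral_of_compact {Φ Φ' : ℝ → E n → ℝ} {a b : ℝ} (hK : IsCompact K)
    (hμ : ∀ᵐ x ∂μ, x ∈ K) (hΦ : ∀ s ∈ Ioo a b, ContinuousOn (Φ s) K)
    (hΦ' : ContinuousOn (Function.uncurry Φ') (Ioo a b ×ˢ K))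
    (hd : ∀ s ∈ Ioo a b, ∀ x ∈ K, HasDerivAt (fun t => Φ t x) (Φ' s x) s) {s : ℝ}
    (hs : s ∈ Ioo a b) :
    HasDerivAt (fun t => ∫ x, Φ t x ∂μ) (∫ x, Φ' s x ∂μ) s := by
  obtain ⟨C, V, hV, hVs, hC⟩ := exists_bound_near hK hΦ' hs
  refine (hasDerivAt_integral_of_dominated_loc_of_deriv_le (bound := fun _ => C) hV
    ?_ (integrable_of_continuousOn hK hμ (hΦ s hs))
    (aestronglyMeasurable_of_continuousOn hK hμ (continuousOn_slice hΦ' hs)) ?_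
    (integrable_const C) ?_).2
  · filter_upwards [hV] with t ht
    exact aestronglyMeasurable_of_continuousOn hK hμ (hΦ t (hVs ht))
  · exact hμ.mono fun x hx t ht => hC t ht x hx
  · exact hμ.mono fun x hx t ht => hd t (hVs ht) x hx

lemma continuousOn_integral_of_compact {Φ : ℝ → E n → ℝ} {a b : ℝ} (hK : IsCompact K)
    (hμ : ∀ᵐ x ∂μ, x ∈ K) (hΦ : ContinuousOn (Function.uncurry Φ) (Ioo a b ×ˢ K)) :
    ContinuousOn (fun s => ∫ x, Φ s x ∂μ) (Ioo a b) := by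
  intro s hs
  obtain ⟨C, V, hV, hVs, hC⟩ := exists_bound_near hK hΦ hs
  refine ContinuousAt.continuousWithinAt ?_
  refine continuousAt_of_dominated (bound := fun _ => C) ?_ ?_ (integrable_const C) ?_
  · filter_upwards [hV] with t ht
    exact aestronglyMeasurable_of_continuousOn hK hμ (continuousOn_slice hΦ (hVs ht))
  · filter_upwards [hV] with t ht
    exact hμ.mono fun x hx => hC t ht x hx
  · refine hμ.mono fun x hx => ?_
    have : ContinuousOn (fun t => Φ t x) (Ioo a b) :=
      hΦ.comp (f := fun t => (t, x)) (by fun_prop) fun _ ht => ⟨ht, hx⟩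
    exact this.continuousAt (Ioo_mem_nhds hs.1 hs.2)

lemma ae_restrict_ball_mem : ∀ᵐ x ∂((volume : Measure (E n)).restrict (ball 0 1)),
    x ∈ closedBall (0 : E n) 1 :=
  (ae_restrict_mem measurableSet_ball).mono fun _ hx => ball_subset_closedBall hx

lemma ae_surface_mem_closedBall : ∀ᵐ x ∂(surface (0 : E n) 1), x ∈ closedBall (0 : E n) 1 :=
  (ae_surface_mem 0 zero_le_one).mono fun _ hx => sphere_subset_closedBall hx

instance : IsFiniteMeasure ((volume : Measure (E n)).restrict (ball 0 1)) :=
  ⟨by simpa using measure_ball_lt_top⟩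

end Parametric

/-! ### The rescaled maps and their radial derivative. -/

section Rescaling

variable {n m : ℕ}

/-- The radial derivative `∂_s u_s` written with the gradient of `u`. -/
noncomputable def radialField (v : E n → E m) (x₀ : E n) (s : ℝ) (x : E n) : E m :=
  (s ^ 2)⁻¹ • fderiv ℝ v (x₀ + s • x) x - (2 * (s ^ 3)⁻¹) • v (x₀ + s • x)

/-- The Dirichlet density of the rescaled map. -/
noncomputable def gradDensity (v : E n → E m) (x₀ : E n) (s : ℝ) (x : E n) : ℝ :=
  1 / 2 * ∑ i, ‖s⁻¹ • vpartial i v (x₀ + s • x)‖ ^ 2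

lemma hasDerivAt_comp_ray {F : Type*} [NormedAddCommGroup F] [NormedSpace ℝ F]
    {v : E n → F} {x₀ x : E n} {s : ℝ} (hv : DifferentiableAt ℝ v (x₀ + s • x)) :
    HasDerivAt (fun t : ℝ => v (x₀ + t • x)) (fderiv ℝ v (x₀ + s • x) x) s := by
  have h : HasDerivAt (fun t : ℝ => x₀ + t • x) x s := by
    simpa using ((hasDerivAt_id s).smul_const x).const_add x₀
  exact hv.hasFDerivAt.comp_hasDerivAt s h

lemma hasDerivAt_rescale {v : E n → E m} {x₀ x : E n} {s : ℝ} (hs : s ≠ 0)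
    (hv : DifferentiableAt ℝ v (x₀ + s • x)) :
    HasDerivAt (fun t => rescale v x₀ t x) (radialField v x₀ s x) s := by
  have h1 : HasDerivAt (fun t : ℝ => (t ^ 2)⁻¹) (-(2 * (s ^ 3)⁻¹)) s := by
    refine ((hasDerivAt_pow 2 s).inv (pow_ne_zero 2 hs)).congr_deriv ?_
    norm_num
    field_simp
  refine (h1.smul (hasDerivAt_comp_ray hv)).congr_deriv ?_
  rw [radialField, neg_smul]
  abel

lemma vpartial_comp_affine {F : Type*} [NormedAddCommGroup F] [NormedSpace ℝ F] {v : E n → F}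
    (hv : Differentiable ℝ v) (x₀ : E n) (s : ℝ) (i : Fin n) (x : E n) :
    vpartial i (fun y => v (x₀ + s • y)) x = s • vpartial i v (x₀ + s • x) := by
  have h : HasFDerivAt (fun y : E n => x₀ + s • y) (s • ContinuousLinearMap.id ℝ (E n)) x :=
    ((hasFDerivAt_id x).const_smul s).const_add x₀
  have h2 : HasFDerivAt (fun y : E n => v (x₀ + s • y)) _ x :=
    (hv (x₀ + s • x)).hasFDerivAt.comp x h
  rw [vpartial, h2.fderiv]
  simp [vpartial]

lemma fderiv_apply_eq_sum (v : E n → E m) (y x : E n) :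
    fderiv ℝ v y x = ∑ i, x i • vpartial i v y := by
  have hx : x = ∑ i, x i • basisVec i := by
    ext j
    simp [Pi.single_apply]
  conv_lhs => rw [hx]
  simp [vpartial]

/-- Symmetry of the second derivative; this is what lets `∂_s` and `∂ᵢ` be exchanged on the rescaled
maps. -/
lemma fderiv_vpartial_comm {v : E n → E m} (hv : ContDiff ℝ ∞ v) (i : Fin n) (y x : E n) :
    fderiv ℝ (vpartial i v) y x = fderiv ℝ (fun z => fderiv ℝ v z x) y (basisVec i) := by
  have h1 : Differentiable ℝ (fderiv ℝ v) :=
    (hv.fderiv_right (m := 1) (by norm_cast)).differentiable (by norm_num)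
  have h2 : ∀ e, HasFDerivAt (fun z => fderiv ℝ v z e)
      ((ContinuousLinearMap.apply ℝ (E m) e).comp (fderiv ℝ (fderiv ℝ v) y)) y := fun e =>
    (ContinuousLinearMap.apply ℝ (E m) e).hasFDerivAt.comp y (h1 y).hasFDerivAt
  have hsymm : IsSymmSndFDerivAt ℝ v y :=
    hv.contDiffAt.isSymmSndFDerivAt (by
      rw [minSmoothness_of_isRCLikeNormedField]
      norm_cast)
  have h3 : HasFDerivAt (vpartial i v) _ y := h2 (basisVec i)
  rw [h3.fderiv, (h2 x).fderiv]
  exact hsymm.eq x (basisVec i)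

/-- The `s`-derivative of the gradient of the rescaled map is the gradient of `∂_s v_s`. -/
lemma vpartial_radialField {v : E n → E m} (hv : ContDiff ℝ ∞ v) (x₀ : E n) {s : ℝ} (hs : s ≠ 0)
    (i : Fin n) (x : E n) :
    vpartial i (radialField v x₀ s) x
      = s⁻¹ • fderiv ℝ (vpartial i v) (x₀ + s • x) x - (s ^ 2)⁻¹ • vpartial i v (x₀ + s • x) := by
  have hvd : Differentiable ℝ v := hv.differentiable (by simp)
  have h1 : Differentiable ℝ (fderiv ℝ v) :=
    (hv.fderiv_right (m := 1) (by norm_cast)).differentiable (by norm_num)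
  have ha : HasFDerivAt (fun y : E n => x₀ + s • y) (s • ContinuousLinearMap.id ℝ (E n)) x :=
    ((hasFDerivAt_id x).const_smul s).const_add x₀
  have hA : HasFDerivAt (fun y => fderiv ℝ v (x₀ + s • y)) _ x :=
    (h1 (x₀ + s • x)).hasFDerivAt.comp x ha
  -- `x` occurs both in the base point and as the direction. The second occurrence contributes `+s⁻²
  -- ∂ᵢv`, which against `-2 s⁻² ∂ᵢv` from the other summand leaves `-s⁻² ∂ᵢv`.
  have hB := hA.clm_apply (hasFDerivAt_id x)
  have hC : HasFDerivAt (fun y => v (x₀ + s • y)) _ x := (hvd (x₀ + s • x)).hasFDerivAt.comp x ha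
  have hD : HasFDerivAt (radialField v x₀ s) _ x :=
    (hB.const_smul (s ^ 2)⁻¹).sub (hC.const_smul (2 * (s ^ 3)⁻¹))
  have h2 : HasFDerivAt (fun z => fderiv ℝ v z x)
      ((ContinuousLinearMap.apply ℝ (E m) x).comp (fderiv ℝ (fderiv ℝ v) (x₀ + s • x)))
      (x₀ + s • x) :=
    (ContinuousLinearMap.apply ℝ (E m) x).hasFDerivAt.comp _ (h1 _).hasFDerivAt
  rw [vpartial, hD.fderiv, fderiv_vpartial_comm hv, h2.fderiv]
  simp only [vpartial, _root_.sub_apply, _root_.smul_apply,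
    _root_.add_apply, ContinuousLinearMap.comp_apply, ContinuousLinearMap.flip_apply,
    ContinuousLinearMap.id_apply, ContinuousLinearMap.apply_apply, id, map_smul, smul_add, smul_smul]
  have e1 : (s ^ 2)⁻¹ * s = s⁻¹ := by field_simp
  have e2 : 2 * (s ^ 3)⁻¹ * s = 2 * (s ^ 2)⁻¹ := by field_simp
  rw [e1, e2]
  module

end Rescaling

/-! ### Derivative of the Dirichlet and boundary energies of a smooth map. -/

section SmoothEnergy

variable {n m : ℕ}

lemma continuousOn_inv_pow (k : ℕ) (S : Set (E n)) {b : ℝ} :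
    ContinuousOn (fun p : ℝ × E n => (p.1 ^ k)⁻¹) (Ioo 0 b ×ˢ S) :=
  ContinuousOn.inv₀ (by fun_prop) fun p hp => pow_ne_zero k hp.1.1.ne'

lemma continuousOn_inv_fst (S : Set (E n)) {b : ℝ} :
    ContinuousOn (fun p : ℝ × E n => p.1⁻¹) (Ioo 0 b ×ˢ S) :=
  ContinuousOn.inv₀ (by fun_prop) fun p hp => hp.1.1.ne'

lemma ray_mem_ball {x₀ x : E n} {s R : ℝ} (hs : s ∈ Ioo 0 R) (hx : x ∈ closedBall (0 : E n) 1) :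
    x₀ + s • x ∈ ball x₀ R := by
  have hx1 : ‖x‖ ≤ 1 := by simpa using hx
  rw [mem_ball, dist_eq_norm, add_sub_cancel_left, norm_smul, Real.norm_of_nonneg hs.1.le]
  nlinarith [hs.1, hs.2]

lemma continuousOn_comp_ray {F : Type*} [TopologicalSpace F] {f : E n → F} {x₀ : E n} {R : ℝ}
    (hf : ContinuousOn f (ball x₀ R)) :
    ContinuousOn (fun p : ℝ × E n => f (x₀ + p.1 • p.2)) (Ioo 0 R ×ˢ closedBall 0 1) :=
  hf.comp (f := fun p : ℝ × E n => x₀ + p.1 • p.2) (by fun_prop) fun _ hp => ray_mem_ball hp.1 hp.2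

lemma continuousOn_radialField {v : E n → E m} {x₀ : E n} {R : ℝ}
    (hv : ContinuousOn v (ball x₀ R)) (hv' : ContinuousOn (fderiv ℝ v) (ball x₀ R)) :
    ContinuousOn (Function.uncurry (radialField v x₀)) (Ioo 0 R ×ˢ closedBall 0 1) :=
  ((continuousOn_inv_pow 2 _).smul ((continuousOn_comp_ray hv').clm_apply continuousOn_snd)).sub
    ((continuousOn_const.mul (continuousOn_inv_pow 3 _)).smul (continuousOn_comp_ray hv))

lemma continuousOn_rescale {v : E n → E m} {x₀ : E n} {R : ℝ}
    (hv : ContinuousOn v (ball x₀ R)) :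
    ContinuousOn (Function.uncurry (rescale v x₀)) (Ioo 0 R ×ˢ closedBall 0 1) :=
  (continuousOn_inv_pow 2 _).smul (continuousOn_comp_ray hv)

lemma contDiff_radialField {v : E n → E m} (hv : ContDiff ℝ ∞ v) (x₀ : E n) (s : ℝ) :
    ContDiff ℝ 1 (radialField v x₀ s) := by
  have h1 : ContDiff ℝ 1 (fderiv ℝ v) := hv.fderiv_right (by norm_cast)
  have h2 : ContDiff ℝ 1 v := hv.of_le (by norm_cast)
  unfold radialField
  fun_prop

/-- The derivative in `s` of the Dirichlet density of the rescaled map. -/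
noncomputable def gradDensityDeriv (v : E n → E m) (x₀ : E n) (s : ℝ) (x : E n) : ℝ :=
  ∑ i, inner ℝ (s⁻¹ • vpartial i v (x₀ + s • x))
    (s⁻¹ • fderiv ℝ (vpartial i v) (x₀ + s • x) x - (s ^ 2)⁻¹ • vpartial i v (x₀ + s • x))

lemma hasDerivAt_gradDensity {v : E n → E m} (hv : ContDiff ℝ ∞ v) (x₀ : E n) {s : ℝ}
    (hs : s ≠ 0) (x : E n) :
    HasDerivAt (fun t => gradDensity v x₀ t x) (gradDensityDeriv v x₀ s x) s := by
  have hd : ∀ i, Differentiable ℝ (vpartial i v) := fun i =>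
    (contDiff_vpartial (k := 1) hv (by norm_cast) i).differentiable (by norm_num)
  have h1 : ∀ i, HasDerivAt (fun t : ℝ => t⁻¹ • vpartial i v (x₀ + t • x))
      (s⁻¹ • fderiv ℝ (vpartial i v) (x₀ + s • x) x - (s ^ 2)⁻¹ • vpartial i v (x₀ + s • x)) s := by
    intro i
    refine ((hasDerivAt_inv hs).smul (hasDerivAt_comp_ray (hd i _))).congr_deriv ?_
    rw [neg_smul]
    abel
  have h2 := (HasDerivAt.fun_sum (u := Finset.univ) fun i _ => (h1 i).norm_sq).const_mul (1 / 2)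
  refine h2.congr_deriv ?_
  rw [gradDensityDeriv, Finset.mul_sum]
  exact Finset.sum_congr rfl fun i _ => by ring

lemma continuousOn_gradDensity {v : E n → E m} {x₀ : E n} {R : ℝ}
    (hv' : ContinuousOn (fderiv ℝ v) (ball x₀ R)) :
    ContinuousOn (Function.uncurry (gradDensity v x₀)) (Ioo 0 R ×ˢ closedBall 0 1) :=
  continuousOn_const.mul (continuousOn_finsetSum _ fun i _ =>
    ((continuousOn_inv_fst _).smul (continuousOn_comp_ray (f := vpartial i v)
      (hv'.clm_apply continuousOn_const))).norm.pow 2)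

lemma continuousOn_gradDensityDeriv {v : E n → E m} (hv : ContDiff ℝ ∞ v) (x₀ : E n) (R : ℝ) :
    ContinuousOn (Function.uncurry (gradDensityDeriv v x₀)) (Ioo 0 R ×ˢ closedBall 0 1) := by
  simp only [Function.uncurry_def, gradDensityDeriv]
  refine continuousOn_finsetSum _ fun i _ => ?_
  have h1 : ContinuousOn (vpartial i v) (ball x₀ R) :=
    (contDiff_vpartial (k := 0) hv (by simp) i).continuous.continuousOn
  have h2 : ContinuousOn (fderiv ℝ (vpartial i v)) (ball x₀ R) :=
    ((contDiff_vpartial (k := 1) hv (by norm_cast) i).continuous_fderiv (by simp)).continuousOn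
  exact ((continuousOn_inv_fst _).smul (continuousOn_comp_ray h1)).inner
    (((continuousOn_inv_fst _).smul ((continuousOn_comp_ray h2).clm_apply continuousOn_snd)).sub
      ((continuousOn_inv_pow 2 _).smul (continuousOn_comp_ray h1)))

lemma continuous_lap {v : E n → E m} (hv : ContDiff ℝ ∞ v) : Continuous (lap v) :=
  continuous_finsetSum _ fun i _ => (contDiff_vpartial (k := 0)
    (contDiff_vpartial (k := ∞) hv (by simp) i) (by simp) i).continuous

/-- Green's formula for the rescaled map and its radial derivative. -/
lemma integral_gradDensityDeriv {v : E n → E m} (hv : ContDiff ℝ ∞ v) (x₀ : E n) {s : ℝ}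
    (hs : s ≠ 0) :
    ∫ x in ball (0 : E n) 1, gradDensityDeriv v x₀ s x
      = (∫ x, inner ℝ (s • radialField v x₀ s x + (2 : ℝ) • rescale v x₀ s x)
          (radialField v x₀ s x) ∂(surface 0 1))
        - ∫ x in ball (0 : E n) 1, inner ℝ (lap v (x₀ + s • x)) (radialField v x₀ s x) := by
  set z := radialField v x₀ s with hz
  have hzc : ContDiff ℝ 1 z := contDiff_radialField hv x₀ s
  have hpc : ∀ i, ContDiff ℝ 1 (vpartial i v) := fun i => contDiff_vpartial hv (by norm_cast) i
  -- The field `⟨∂ᵢv_s, ∂_s v_s⟩`; its divergence is `⟨Δv_s, ∂_s v_s⟩` plus the derivative of the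
  -- Dirichlet density.
  let h : Fin n → E n → ℝ := fun i x => inner ℝ (s⁻¹ • vpartial i v (x₀ + s • x)) (z x)
  have hh : ∀ i, ContDiff ℝ 1 (h i) := fun i => by
    have := hpc i
    exact ContDiff.inner ℝ (by fun_prop) hzc
  have hB : ∀ {f : E n → ℝ}, Continuous f →
      Integrable f ((volume : Measure (E n)).restrict (ball 0 1)) := fun hf =>
    integrable_of_continuousOn (isCompact_closedBall 0 1) ae_restrict_ball_mem hf.continuousOn
  have hS : ∀ {f : E n → ℝ}, Continuous f → Integrable f (surface (0 : E n) 1) := fun hf =>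
    integrable_of_continuousOn (isCompact_closedBall 0 1) ae_surface_mem_closedBall
      hf.continuousOn
  have hpart : ∀ i x, vpartial i (h i) x
      = inner ℝ (vpartial i (vpartial i v) (x₀ + s • x)) (z x)
        + inner ℝ (s⁻¹ • vpartial i v (x₀ + s • x)) (vpartial i z x) := by
    intro i x
    have hd1 : Differentiable ℝ (fun y => s⁻¹ • vpartial i v (x₀ + s • y)) := by
      have := (hpc i).differentiable (by norm_num)
      fun_prop
    have h1 := fderiv_inner_apply ℝ (hd1 x) (hzc.differentiable (by norm_num) x) (basisVec i)
    have h2 : fderiv ℝ (fun y => s⁻¹ • vpartial i v (x₀ + s • y)) x (basisVec i)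
        = vpartial i (vpartial i v) (x₀ + s • x) := by
      have hd2 : Differentiable ℝ (fun y => vpartial i v (x₀ + s • y)) := by
        have := (hpc i).differentiable (by norm_num)
        fun_prop
      have h3 := vpartial_comp_affine ((hpc i).differentiable (by norm_num)) x₀ s i x
      rw [fderiv_fun_const_smul (hd2 x)]
      rw [vpartial] at h3
      simp [h3, smul_smul, inv_mul_cancel₀ hs]
    rw [h2] at h1
    rw [vpartial, h1, add_comm]
    rfl
  have hsum : ∀ x, ∑ i, vpartial i (h i) x
      = inner ℝ (lap v (x₀ + s • x)) (z x) + gradDensityDeriv v x₀ s x := by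
    intro x
    simp only [hpart, Finset.sum_add_distrib, lap, sum_inner, gradDensityDeriv]
    congr 1
    exact Finset.sum_congr rfl fun i _ => by rw [hz, vpartial_radialField hv x₀ hs]
  have hlapc : Continuous fun x => inner ℝ (lap v (x₀ + s • x)) (z x) := by
    have h1 := continuous_lap hv
    have h2 := hzc.continuous
    fun_prop
  have hDc : Continuous (gradDensityDeriv v x₀ s) := by
    have : gradDensityDeriv v x₀ s = fun x => ∑ i, vpartial i (h i) x
        - inner ℝ (lap v (x₀ + s • x)) (z x) := by
      ext x
      rw [hsum]; ring
    rw [this]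
    exact (continuous_finsetSum _ fun i _ =>
      (contDiff_vpartial (k := 0) (hh i) (by simp) i).continuous).sub hlapc
  have hdiv : ∑ i, ∫ x in ball (0 : E n) 1, vpartial i (h i) x
      = ∑ i, ∫ x, x i * h i x ∂(surface 0 1) :=
    Finset.sum_congr rfl fun i _ => integral_vpartial_ball (hh i) i
  rw [← integral_finsetSum _ fun i _ =>
      hB (contDiff_vpartial (k := 0) (hh i) (by simp) i).continuous,
    ← integral_finsetSum _ fun i _ => hS (by
      have := (hh i).continuous
      fun_prop)] at hdiv
  simp only [hsum] at hdiv
  rw [integral_add (hB hlapc) (hB hDc)] at hdiv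
  rw [eq_sub_iff_add_eq, add_comm, hdiv]
  refine integral_congr_ae (Eventually.of_forall fun x => ?_)
  -- Scaling identity `x · ∇v_s = s ∂_s v_s + 2 v_s`, where `2` is the exponent of the rescaling.
  have e1 : s • z x + (2 : ℝ) • rescale v x₀ s x = ∑ i, x i • s⁻¹ • vpartial i v (x₀ + s • x) := by
    have : ∑ i, x i • s⁻¹ • vpartial i v (x₀ + s • x) = s⁻¹ • fderiv ℝ v (x₀ + s • x) x := by
      rw [fderiv_apply_eq_sum, Finset.smul_sum]
      exact Finset.sum_congr rfl fun i _ => smul_comm _ _ _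
    rw [this, hz, radialField, rescale, smul_sub, smul_smul, smul_smul, smul_smul]
    have e1 : s * (s ^ 2)⁻¹ = s⁻¹ := by field_simp
    have e2 : s * (2 * (s ^ 3)⁻¹) = 2 * (s ^ 2)⁻¹ := by field_simp
    rw [e1, e2]
    abel
  simp only [e1, sum_inner, h, real_inner_smul_left]

/-- The derivative of the rescaled Dirichlet energy minus the boundary term. -/
theorem hasDerivAt_smooth_energy {v : E n → E m} (hv : ContDiff ℝ ∞ v) (x₀ : E n) {s : ℝ}
    (hs : 0 < s) :
    HasDerivAt (fun t => (∫ x in ball (0 : E n) 1, gradDensity v x₀ t x)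
        - ∫ x, ‖rescale v x₀ t x‖ ^ 2 ∂(surface 0 1))
      (s * (∫ x, ‖radialField v x₀ s x‖ ^ 2 ∂(surface 0 1))
        - ∫ x in ball (0 : E n) 1, inner ℝ (lap v (x₀ + s • x)) (radialField v x₀ s x)) s := by
  have hmem : s ∈ Ioo 0 (s + 1) := ⟨hs, by linarith⟩
  have hvc : ContinuousOn v (ball x₀ (s + 1)) := hv.continuous.continuousOn
  have hvc' : ContinuousOn (fderiv ℝ v) (ball x₀ (s + 1)) :=
    (hv.continuous_fderiv (by simp)).continuousOn
  have hK : IsCompact (closedBall (0 : E n) 1) := isCompact_closedBall 0 1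
  have hz := continuousOn_radialField hvc hvc'
  have hr := continuousOn_rescale hvc
  have hr2 : ContinuousOn (Function.uncurry fun t x => ‖rescale v x₀ t x‖ ^ 2)
      (Ioo 0 (s + 1) ×ˢ closedBall 0 1) := hr.norm.pow 2
  have hz2 : ContinuousOn (Function.uncurry fun t x => t * ‖radialField v x₀ t x‖ ^ 2)
      (Ioo 0 (s + 1) ×ˢ closedBall 0 1) := continuousOn_fst.mul (hz.norm.pow 2)
  have hrz : ContinuousOn
      (Function.uncurry fun t x => 2 * inner ℝ (rescale v x₀ t x) (radialField v x₀ t x))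
      (Ioo 0 (s + 1) ×ˢ closedBall 0 1) := continuousOn_const.mul (hr.inner hz)
  have h1 : HasDerivAt (fun t => ∫ x in ball (0 : E n) 1, gradDensity v x₀ t x)
      (∫ x in ball (0 : E n) 1, gradDensityDeriv v x₀ s x) s :=
    hasDerivAt_integral_of_compact hK ae_restrict_ball_mem
      (fun t ht => continuousOn_slice (continuousOn_gradDensity hvc') ht)
      (continuousOn_gradDensityDeriv hv x₀ (s + 1))
      (fun t ht x _ => hasDerivAt_gradDensity hv x₀ ht.1.ne' x) hmem
  have h2 : HasDerivAt (fun t => ∫ x, ‖rescale v x₀ t x‖ ^ 2 ∂(surface 0 1))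
      (∫ x, 2 * inner ℝ (rescale v x₀ s x) (radialField v x₀ s x) ∂(surface 0 1)) s :=
    hasDerivAt_integral_of_compact (Φ := fun t x => ‖rescale v x₀ t x‖ ^ 2)
      (Φ' := fun t x => 2 * inner ℝ (rescale v x₀ t x) (radialField v x₀ t x))
      hK ae_surface_mem_closedBall
      (fun t ht => continuousOn_slice hr2 ht) hrz
      (fun t ht x _ => (hasDerivAt_rescale ht.1.ne' (hv.differentiable (by simp) _)).norm_sq) hmem
  refine (h1.sub h2).congr_deriv ?_
  rw [integral_gradDensityDeriv hv x₀ hs.ne']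
  have hS : ∀ {f : E n → ℝ}, ContinuousOn f (closedBall 0 1) → Integrable f (surface (0 : E n) 1) :=
    fun hf => integrable_of_continuousOn hK ae_surface_mem_closedBall hf
  have i1 : Integrable (fun x => s * ‖radialField v x₀ s x‖ ^ 2) (surface (0 : E n) 1) :=
    hS (continuousOn_slice hz2 hmem)
  have i2 : Integrable (fun x => 2 * inner ℝ (rescale v x₀ s x) (radialField v x₀ s x))
      (surface (0 : E n) 1) :=
    hS (continuousOn_slice hrz hmem)
  -- The second summand is exactly the derivative of `‖v_s‖²`, so it cancels against the boundary
  -- energy and only the square remains.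
  have e1 : ∀ x, inner ℝ (s • radialField v x₀ s x + (2 : ℝ) • rescale v x₀ s x)
      (radialField v x₀ s x) = s * ‖radialField v x₀ s x‖ ^ 2
        + 2 * inner ℝ (rescale v x₀ s x) (radialField v x₀ s x) := fun x => by
    rw [inner_add_left, real_inner_smul_left, real_inner_smul_left, real_inner_self_eq_norm_sq]
  simp only [e1]
  rw [integral_add i1 i2, integral_const_mul]
  ring

end SmoothEnergy

/-! ### Regularised potential. -/

section Potential

variable {n m : ℕ}

/-- A smooth approximation of the potential `g(y) |y|`. -/
noncomputable def smoothPotential (g : E m → ℝ) (δ : ℝ) (y : E m) : ℝ :=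
  g y * √(‖y‖ ^ 2 + δ ^ 2)

/-- The gradient of `smoothPotential`. -/
noncomputable def smoothRhs (g : E m → ℝ) (δ : ℝ) (y : E m) : E m :=
  g y • ((√(‖y‖ ^ 2 + δ ^ 2))⁻¹ • y) + √(‖y‖ ^ 2 + δ ^ 2) • gradient g y

variable {g : E m → ℝ} {θ δ : ℝ}

lemma hasDerivAt_smoothPotential (hg : ContDiffOn ℝ 2 g (ball 0 θ)) (hδ : 0 < δ) {γ : ℝ → E m}
    {γ' : E m} {s : ℝ} (hγ : HasDerivAt γ γ' s) (hs : ‖γ s‖ < θ) :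
    HasDerivAt (fun t => smoothPotential g δ (γ t)) (inner ℝ (smoothRhs g δ (γ s)) γ') s := by
  have hpos : 0 < ‖γ s‖ ^ 2 + δ ^ 2 := by positivity
  have h1 : HasDerivAt (fun t => g (γ t)) (inner ℝ (gradient g (γ s)) γ') s := by
    refine ((hasFDerivAt_of_contDiffOn_ball hg hs).comp_hasDerivAt s hγ).congr_deriv ?_
    simp [gradient]
  have h2 := (hγ.norm_sq.add_const (δ ^ 2)).sqrt hpos.ne'
  refine (h1.mul h2).congr_deriv ?_
  simp only [smoothRhs, inner_add_left, real_inner_smul_left]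
  field_simp
  ring

lemma continuousOn_smoothPotential (hg : ContDiffOn ℝ 2 g (ball 0 θ)) :
    ContinuousOn (smoothPotential g δ) (ball 0 θ) :=
  hg.continuousOn.mul (by fun_prop)

lemma continuousOn_smoothRhs (hg : ContDiffOn ℝ 2 g (ball 0 θ)) (hδ : 0 < δ) :
    ContinuousOn (smoothRhs g δ) (ball 0 θ) := by
  have h1 : ContinuousOn (fun y : E m => (√(‖y‖ ^ 2 + δ ^ 2))⁻¹) (ball 0 θ) :=
    ContinuousOn.inv₀ (by fun_prop) fun y _ => by positivity
  have h2 : ContinuousOn (fun y : E m => √(‖y‖ ^ 2 + δ ^ 2)) (ball 0 θ) := by fun_prop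
  exact (hg.continuousOn.smul (h1.smul continuousOn_id)).add
    (h2.smul (continuousOn_gradient hg))

lemma tendsto_sqrt_sq_add (y : E m) {δ : ℕ → ℝ} (hδ : Tendsto δ atTop (𝓝 0)) :
    Tendsto (fun k => √(‖y‖ ^ 2 + δ k ^ 2)) atTop (𝓝 ‖y‖) := by
  have hc : Continuous fun t : ℝ => √(‖y‖ ^ 2 + t ^ 2) := by fun_prop
  simpa [Function.comp_def] using (hc.tendsto 0).comp hδ

lemma tendsto_smoothPotential (y : E m) {δ : ℕ → ℝ} (hδ : Tendsto δ atTop (𝓝 0)) :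
    Tendsto (fun k => smoothPotential g (δ k) y) atTop (𝓝 (g y * ‖y‖)) :=
  (tendsto_sqrt_sq_add y hδ).const_mul _

/-- At `y = 0` the first summand is constantly `0`, which matches the value of `rhs` there; the zero
set of `u` therefore needs no separate treatment. -/
lemma tendsto_smoothRhs (y : E m) {δ : ℕ → ℝ} (hδ : Tendsto δ atTop (𝓝 0)) :
    Tendsto (fun k => smoothRhs g (δ k) y) atTop (𝓝 (rhs g y)) := by
  refine Tendsto.add ?_ ((tendsto_sqrt_sq_add y hδ).smul_const _)
  rcases eq_or_ne y 0 with rfl | hy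
  · simp
  · exact (((tendsto_sqrt_sq_add y hδ).inv₀ (norm_ne_zero_iff.2 hy)).smul_const y).const_smul _

lemma norm_le_sqrt_sq_add (y : E m) (δ : ℝ) : ‖y‖ ≤ √(‖y‖ ^ 2 + δ ^ 2) :=
  Real.le_sqrt_of_sq_le (by nlinarith [sq_nonneg δ])

lemma sqrt_sq_add_le (y : E m) (hδ : 0 ≤ δ) (hδ1 : δ ≤ 1) : √(‖y‖ ^ 2 + δ ^ 2) ≤ ‖y‖ + 1 := by
  rw [Real.sqrt_le_left (by positivity)]
  nlinarith [norm_nonneg y]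

lemma abs_smoothPotential_le (y : E m) (hδ : 0 ≤ δ) (hδ1 : δ ≤ 1) :
    |smoothPotential g δ y| ≤ |g y| * (‖y‖ + 1) := by
  rw [smoothPotential, abs_mul, abs_of_nonneg (Real.sqrt_nonneg _)]
  exact mul_le_mul_of_nonneg_left (sqrt_sq_add_le y hδ hδ1) (abs_nonneg _)

/-- The inverse root is absorbed by `‖y‖ ≤ √(‖y‖² + δ²)`; the bound is independent of `δ` and
supplies the domination in the limit. -/
lemma norm_smoothRhs_le (y : E m) (hδ : 0 ≤ δ) (hδ1 : δ ≤ 1) :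
    ‖smoothRhs g δ y‖ ≤ |g y| + (‖y‖ + 1) * ‖gradient g y‖ := by
  refine (norm_add_le _ _).trans (add_le_add ?_ ?_)
  · rw [norm_smul, norm_smul, norm_inv, Real.norm_eq_abs, Real.norm_eq_abs,
      abs_of_nonneg (Real.sqrt_nonneg _)]
    refine mul_le_of_le_one_right (abs_nonneg _) ?_
    rw [inv_mul_eq_div]
    exact div_le_one_of_le₀ (norm_le_sqrt_sq_add y δ) (Real.sqrt_nonneg _)
  · rw [norm_smul, Real.norm_eq_abs, abs_of_nonneg (Real.sqrt_nonneg _)]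
    exact mul_le_mul_of_nonneg_right (sqrt_sq_add_le y hδ hδ1) (norm_nonneg _)

/-- Euler's identity for `g(y)|y|`: were `g` constant, the potential would come back; the excess
from the gradient of `g` becomes the error term. -/
lemma inner_rhs_self (y : E m) :
    inner ℝ (rhs g y) y = g y * ‖y‖ + ‖y‖ * inner ℝ (gradient g y) y := by
  rw [rhs, inner_add_left, real_inner_smul_left, real_inner_smul_left, real_inner_smul_left,
    real_inner_self_eq_norm_sq]
  congr 2
  rcases eq_or_ne y 0 with rfl | hy
  · simp
  · have := norm_ne_zero_iff.2 hy
    field_simp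

variable {u : E n → E m} {x₀ : E n} {R : ℝ}

/-- The derivative in `s` of the rescaled potential `s⁻² F_δ(u(x₀ + s x))`. -/
noncomputable def potentialDeriv (g : E m → ℝ) (u : E n → E m) (x₀ : E n) (δ s : ℝ) (x : E n) :
    ℝ :=
  (s ^ 2)⁻¹ * inner ℝ (smoothRhs g δ (u (x₀ + s • x))) (fderiv ℝ u (x₀ + s • x) x)
    - 2 * (s ^ 3)⁻¹ * smoothPotential g δ (u (x₀ + s • x))

lemma continuousOn_potential (hg : ContDiffOn ℝ 2 g (ball 0 θ)) (hu : ContinuousOn u (ball x₀ R))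
    (hθ : ∀ x ∈ ball x₀ R, ‖u x‖ < θ) :
    ContinuousOn
      (Function.uncurry fun (s : ℝ) x => (s ^ 2)⁻¹ * smoothPotential g δ (u (x₀ + s • x)))
      (Ioo 0 R ×ˢ closedBall 0 1) :=
  (continuousOn_inv_pow 2 _).mul (continuousOn_comp_ray (f := fun y => smoothPotential g δ (u y))
    ((continuousOn_smoothPotential hg).comp hu fun x hx => by simpa using hθ x hx))

lemma continuousOn_potentialDeriv (hg : ContDiffOn ℝ 2 g (ball 0 θ)) (hδ : 0 < δ)
    (hu : ContinuousOn u (ball x₀ R)) (hu' : ContinuousOn (fderiv ℝ u) (ball x₀ R))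
    (hθ : ∀ x ∈ ball x₀ R, ‖u x‖ < θ) :
    ContinuousOn (Function.uncurry (potentialDeriv g u x₀ δ)) (Ioo 0 R ×ˢ closedBall 0 1) := by
  have hmaps : MapsTo u (ball x₀ R) (ball 0 θ) := fun x hx => by simpa using hθ x hx
  have h1 := continuousOn_comp_ray (f := fun y => smoothPotential g δ (u y))
    ((continuousOn_smoothPotential hg).comp hu hmaps)
  have h2 := continuousOn_comp_ray (f := fun y => smoothRhs g δ (u y))
    ((continuousOn_smoothRhs hg hδ).comp hu hmaps)
  exact ((continuousOn_inv_pow 2 _).mul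
    (h2.inner ((continuousOn_comp_ray hu').clm_apply continuousOn_snd))).sub
    ((continuousOn_const.mul (continuousOn_inv_pow 3 _)).mul h1)

/-- Only first derivatives of `u` enter, so the potential can be kept at `u`; the mollified maps
never have to take values in the ball where `g` is smooth. -/
lemma hasDerivAt_integral_potential (hg : ContDiffOn ℝ 2 g (ball 0 θ)) (hδ : 0 < δ)
    (hu : ContinuousOn u (ball x₀ R)) (hu' : ContinuousOn (fderiv ℝ u) (ball x₀ R))
    (hud : ∀ x ∈ ball x₀ R, DifferentiableAt ℝ u x)
    (hθ : ∀ x ∈ ball x₀ R, ‖u x‖ < θ) {s : ℝ} (hs : s ∈ Ioo 0 R) :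
    HasDerivAt (fun t => ∫ x in ball (0 : E n) 1,
        (t ^ 2)⁻¹ * smoothPotential g δ (u (x₀ + t • x)))
      (∫ x in ball (0 : E n) 1, potentialDeriv g u x₀ δ s x) s := by
  refine hasDerivAt_integral_of_compact (isCompact_closedBall 0 1) ae_restrict_ball_mem
    (fun t ht => continuousOn_slice (continuousOn_potential hg hu hθ) ht)
    (continuousOn_potentialDeriv hg hδ hu hu' hθ) (fun t ht x hx => ?_) hs
  have ht0 : t ≠ 0 := ht.1.ne'
  have hmem := ray_mem_ball (x₀ := x₀) ht hx
  have h1 : HasDerivAt (fun t : ℝ => (t ^ 2)⁻¹) (-(2 * (t ^ 3)⁻¹)) t := by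
    refine ((hasDerivAt_pow 2 t).inv (pow_ne_zero 2 ht0)).congr_deriv ?_
    norm_num
    field_simp
  have h2 := hasDerivAt_smoothPotential hg hδ (hasDerivAt_comp_ray (hud _ hmem)) (hθ _ hmem)
  refine (h1.mul h2).congr_deriv ?_
  rw [potentialDeriv]
  ring

end Potential

/-! ### Passing to the limit in derivatives; change of variables. -/

section Limit

variable {n m : ℕ}

/-- Write `W k` as the integral of `T k`, pass to the limit by bounded convergence, and
differentiate again using continuity of `T'`. Pointwise convergence of the derivatives is enough. -/
lemma hasDerivAt_of_tendsto_of_bounded {W T : ℕ → ℝ → ℝ} {W' T' : ℝ → ℝ} {a b C : ℝ}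
    (hW : ∀ k, ∀ s ∈ Ioo a b, HasDerivAt (W k) (T k s) s)
    (hT : ∀ k, ContinuousOn (T k) (Ioo a b)) (hT' : ContinuousOn T' (Ioo a b))
    (hC : ∀ k, ∀ s ∈ Ioo a b, ‖T k s‖ ≤ C)
    (hWlim : ∀ s ∈ Ioo a b, Tendsto (fun k => W k s) atTop (𝓝 (W' s)))
    (hTlim : ∀ s ∈ Ioo a b, Tendsto (fun k => T k s) atTop (𝓝 (T' s))) {r : ℝ}
    (hr : r ∈ Ioo a b) : HasDerivAt W' (T' r) r := by
  have hsub : ∀ s ∈ Ioo a b, uIcc r s ⊆ Ioo a b := fun s hs =>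
    (ordConnected_Ioo).uIcc_subset hr hs
  have key : ∀ s ∈ Ioo a b, W' s = W' r + ∫ t in r..s, T' t := by
    intro s hs
    have h1 : ∀ k, W k s - W k r = ∫ t in r..s, T k t := fun k =>
      (intervalIntegral.integral_eq_sub_of_hasDerivAt (fun t ht => hW k t (hsub s hs ht))
        ((hT k).mono (hsub s hs)).intervalIntegrable).symm
    have h2 : Tendsto (fun k => ∫ t in r..s, T k t) atTop (𝓝 (∫ t in r..s, T' t)) := by
      refine intervalIntegral.tendsto_integral_filter_of_dominated_convergence (fun _ => C)
        (Eventually.of_forall fun k => ?_) (Eventually.of_forall fun k => ?_)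
        intervalIntegrable_const ?_
      · exact (((hT k).mono (hsub s hs)).intervalIntegrable).aestronglyMeasurable_restrict_uIoc
      · exact Eventually.of_forall fun t ht => hC k t (hsub s hs (uIoc_subset_uIcc ht))
      · exact Eventually.of_forall fun t ht => hTlim t (hsub s hs (uIoc_subset_uIcc ht))
    have h3 := ((hWlim s hs).sub (hWlim r hr)).congr h1
    linarith [tendsto_nhds_unique h3 h2]
  have hnhds : Ioo a b ∈ 𝓝 r := Ioo_mem_nhds hr.1 hr.2
  have h4 : HasDerivAt (fun s => W' r + ∫ t in r..s, T' t) (T' r) r := by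
    refine HasDerivAt.const_add _ (intervalIntegral.integral_hasDerivAt_right (by simp) ?_
      (hT'.continuousAt hnhds))
    exact hT'.stronglyMeasurableAtFilter isOpen_Ioo r hr
  exact h4.congr_of_eventuallyEq (by filter_upwards [hnhds] with s hs using key s hs)

lemma tendsto_integral_of_compact {μ : Measure (E n)} [IsFiniteMeasure μ] {K : Set (E n)}
    (hK : IsCompact K) (hμ : ∀ᵐ x ∂μ, x ∈ K) {f : ℕ → E n → ℝ} {f' : E n → ℝ} {C : ℝ}
    (hf : ∀ k, ContinuousOn (f k) K) (hC : ∀ k, ∀ x ∈ K, ‖f k x‖ ≤ C)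
    (hlim : ∀ᵐ x ∂μ, Tendsto (fun k => f k x) atTop (𝓝 (f' x))) :
    Tendsto (fun k => ∫ x, f k x ∂μ) atTop (𝓝 (∫ x, f' x ∂μ)) :=
  tendsto_integral_of_dominated_convergence (fun _ => C)
    (fun k => aestronglyMeasurable_of_continuousOn hK hμ (hf k)) (integrable_const C)
    (fun k => hμ.mono fun x hx => hC k x hx) hlim

/-- For `s ≠ 0` the map `x ↦ x₀ + s x` pulls null sets back to null sets. -/
lemma ae_comp_ray {x₀ : E n} {R s : ℝ} (hs : s ∈ Ioo 0 R) {p : E n → Prop}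
    (hp : ∀ᵐ y ∂(volume.restrict (ball x₀ R)), p y) :
    ∀ᵐ x ∂(volume.restrict (ball (0 : E n) 1)), p (x₀ + s • x) := by
  have hq1 : Measure.QuasiMeasurePreserving (fun x : E n => s • x) volume volume := by
    refine ⟨by fun_prop, ?_⟩
    rw [Measure.map_addHaar_smul volume hs.1.ne']
    exact Measure.smul_absolutelyContinuous
  have hq2 : Measure.QuasiMeasurePreserving (fun x : E n => x₀ + x) volume volume :=
    (measurePreserving_add_left volume x₀).quasiMeasurePreserving
  rw [ae_restrict_iff' measurableSet_ball] at hp ⊢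
  filter_upwards [(hq2.comp hq1).ae hp] with x hx hx1
  exact hx (ray_mem_ball hs (ball_subset_closedBall hx1))

open scoped Pointwise in
lemma setIntegral_ball_rescale (x₀ : E n) {s : ℝ} (hs : 0 < s) (f : E n → ℝ) :
    ∫ x in ball x₀ s, f x = s ^ n * ∫ x in ball (0 : E n) 1, f (x₀ + s • x) := by
  have h1 : ∫ x in ball x₀ s, f x = ∫ x in ball (0 : E n) s, f (x₀ + x) := by
    have := (measurePreserving_add_left (volume : Measure (E n)) x₀).setIntegral_preimage_emb
      (measurableEmbedding_addLeft x₀) f (ball x₀ s)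
    rw [← this]
    congr 2
    ext x
    simp
  have h2 := Measure.setIntegral_comp_smul_of_pos (volume : Measure (E n))
    (fun x => f (x₀ + x)) (ball 0 1) hs
  have h3 : s • ball (0 : E n) 1 = ball 0 s := by
    rw [smul_unitBall hs.ne', Real.norm_of_nonneg hs.le]
  rw [h3] at h2
  rw [h1, h2]
  simp [hs.ne']

end Limit

/-! ### Energy in unit scale, uniform bounds, and the bulk cancellation. -/

section Energy

variable {n m : ℕ} {g : E m → ℝ} {θ : ℝ} {u : E n → E m} {x₀ : E n} {R : ℝ}

lemma continuousOn_potential_zero (hg : ContDiffOn ℝ 2 g (ball 0 θ))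
    (hu : ContinuousOn u (ball x₀ R)) (hθ : ∀ x ∈ ball x₀ R, ‖u x‖ < θ) :
    ContinuousOn (Function.uncurry fun (s : ℝ) x =>
      (s ^ 2)⁻¹ * (g (u (x₀ + s • x)) * ‖u (x₀ + s • x)‖)) (Ioo 0 R ×ˢ closedBall 0 1) :=
  (continuousOn_inv_pow 2 _).mul (continuousOn_comp_ray (f := fun y => g (u y) * ‖u y‖)
    ((continuousOn_comp_of_contDiffOn hg hu hθ).mul hu.norm))

lemma continuousOn_errorDensity (hg : ContDiffOn ℝ 2 g (ball 0 θ))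
    (hu : ContinuousOn u (ball x₀ R)) (hθ : ∀ x ∈ ball x₀ R, ‖u x‖ < θ) :
    ContinuousOn (Function.uncurry (errorDensity g u x₀)) (Ioo 0 R ×ˢ closedBall 0 1) :=
  ((continuousOn_comp_ray (f := fun y => gradient g (u y))
    (continuousOn_comp_gradient hg hu hθ)).inner (continuousOn_rescale hu)).mul
    (continuousOn_rescale hu).norm

/-- The Weiss energy in terms of integrals over the unit ball and the unit sphere. -/
lemma weiss_eq {G : Fin n → E n → E m} (hn : 0 < n) (hg : ContDiffOn ℝ 2 g (ball 0 θ))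
    (hu : ContinuousOn u (ball x₀ R)) (hu' : ContinuousOn (fderiv ℝ u) (ball x₀ R))
    (hθ : ∀ x ∈ ball x₀ R, ‖u x‖ < θ)
    (hG : ∀ i, ∀ᵐ x ∂(volume.restrict (ball x₀ R)), G i x = vpartial i u x) {s : ℝ}
    (hs : s ∈ Ioo 0 R) :
    weiss g u G x₀ s = (∫ x in ball (0 : E n) 1, gradDensity u x₀ s x)
      - (∫ x, ‖rescale u x₀ s x‖ ^ 2 ∂(surface 0 1))
      + ∫ x in ball (0 : E n) 1, (s ^ 2)⁻¹ * (g (u (x₀ + s • x)) * ‖u (x₀ + s • x)‖) := by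
  have hs0 : s ≠ 0 := hs.1.ne'
  have hK : IsCompact (closedBall (0 : E n) 1) := isCompact_closedBall 0 1
  have hsub : ball x₀ s ⊆ ball x₀ R := ball_subset_ball hs.2.le
  have h1 : ∫ x in ball x₀ s, density g u G x
      = ∫ x in ball x₀ s, density g u (fun i => vpartial i u) x := by
    refine integral_congr_ae ?_
    have := ae_all_iff.2 fun i => ae_restrict_of_ae_restrict_of_subset hsub (hG i)
    filter_upwards [this] with x hx
    simp only [density, hx]
  have h2 : 1 / s ^ (n + 2) * ∫ x in ball x₀ s, density g u G x
      = (∫ x in ball (0 : E n) 1, gradDensity u x₀ s x)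
        + ∫ x in ball (0 : E n) 1, (s ^ 2)⁻¹ * (g (u (x₀ + s • x)) * ‖u (x₀ + s • x)‖) := by
    rw [h1, setIntegral_ball_rescale x₀ hs.1, ← mul_assoc,
      ← integral_add
        (integrable_of_continuousOn hK ae_restrict_ball_mem
          (continuousOn_slice (continuousOn_gradDensity hu') hs))
        (integrable_of_continuousOn hK ae_restrict_ball_mem
          (continuousOn_slice (continuousOn_potential_zero hg hu hθ) hs)),
      ← integral_const_mul]
    refine integral_congr_ae (Eventually.of_forall fun x => ?_)
    have e1 : 1 / s ^ (n + 2) * s ^ n = (s ^ 2)⁻¹ := by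
      rw [pow_add]; field_simp
    simp only [density, gradDensity, e1, norm_smul, mul_pow, ← Finset.mul_sum]
    rw [norm_inv, inv_pow, Real.norm_eq_abs, sq_abs]
    ring
  have h3 : 1 / s ^ (n + 3) * (∫ x, ‖u x‖ ^ 2 ∂(surface x₀ s))
      = ∫ x, ‖rescale u x₀ s x‖ ^ 2 ∂(surface 0 1) := by
    rw [integral_surface_rescale x₀ hs.1, smul_eq_mul, ← mul_assoc, ← integral_const_mul]
    refine integral_congr_ae (Eventually.of_forall fun x => ?_)
    have e1 : 1 / s ^ (n + 3) * s ^ (n - 1) = ((s ^ 2)⁻¹) ^ 2 := by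
      -- Positivity of `n` makes the truncated exponent `n - 1` genuine; the powers then combine to
      -- `s⁻⁴`.
      obtain ⟨k, rfl⟩ : ∃ k, n = k + 1 := ⟨n - 1, by omega⟩
      simp only [add_tsub_cancel_right]
      field_simp
      ring
    simp only [rescale, e1, norm_smul, mul_pow, Real.norm_eq_abs, sq_abs]
  rw [weiss, h2, h3]
  ring

/-- The combined bulk term of the derivative of the approximate energies. -/
noncomputable def bulkTerm (g : E m → ℝ) (u v : E n → E m) (x₀ : E n) (δ s : ℝ) (x : E n) : ℝ :=
  potentialDeriv g u x₀ δ s x - inner ℝ (lap v (x₀ + s • x)) (radialField v x₀ s x)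

/-- Negative powers of `s` blow up at `0`, so the bound is taken over radii above a fixed `a > 0`.
-/
lemma norm_radialField_le {v : E n → E m} {C a : ℝ} (ha : 0 < a)
    (h0 : ∀ x ∈ ball x₀ R, ‖v x‖ ≤ C) (h1 : ∀ x ∈ ball x₀ R, ‖fderiv ℝ v x‖ ≤ C) {s : ℝ}
    (hs : s ∈ Ioo a R) {x : E n} (hx : x ∈ closedBall (0 : E n) 1) :
    ‖radialField v x₀ s x‖ ≤ (a ^ 2)⁻¹ * C + 2 * (a ^ 3)⁻¹ * C := by
  have hs0 : 0 < s := ha.trans hs.1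
  have hmem : x₀ + s • x ∈ ball x₀ R := ray_mem_ball ⟨hs0, hs.2⟩ hx
  have hx1 : ‖x‖ ≤ 1 := by simpa using hx
  have hC0 : 0 ≤ C := (norm_nonneg _).trans (h0 _ hmem)
  have e1 : (s ^ 2)⁻¹ ≤ (a ^ 2)⁻¹ := by gcongr; exact hs.1.le
  have e2 : (s ^ 3)⁻¹ ≤ (a ^ 3)⁻¹ := by gcongr; exact hs.1.le
  have e3 : ‖fderiv ℝ v (x₀ + s • x) x‖ ≤ C :=
    ((fderiv ℝ v (x₀ + s • x)).le_opNorm x).trans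
      ((mul_le_of_le_one_right (norm_nonneg _) hx1).trans (h1 _ hmem))
  refine (norm_sub_le _ _).trans (add_le_add ?_ ?_)
  · rw [norm_smul, Real.norm_of_nonneg (by positivity)]
    exact mul_le_mul e1 e3 (norm_nonneg _) (by positivity)
  · rw [norm_smul, Real.norm_of_nonneg (by positivity)]
    exact mul_le_mul (by linarith) (h0 _ hmem) (norm_nonneg _) (by positivity)

lemma norm_potentialDeriv_le {A C a δ : ℝ} (ha : 0 < a) (hδ : 0 ≤ δ) (hδ1 : δ ≤ 1)
    (hA : ∀ x ∈ ball x₀ R, |g (u x)| ≤ A ∧ ‖u x‖ ≤ A ∧ ‖gradient g (u x)‖ ≤ A)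
    (h1 : ∀ x ∈ ball x₀ R, ‖fderiv ℝ u x‖ ≤ C) {s : ℝ}
    (hs : s ∈ Ioo a R) {x : E n} (hx : x ∈ closedBall (0 : E n) 1) :
    ‖potentialDeriv g u x₀ δ s x‖
      ≤ (a ^ 2)⁻¹ * ((A + (A + 1) * A) * C) + 2 * (a ^ 3)⁻¹ * (A * (A + 1)) := by
  have hs0 : 0 < s := ha.trans hs.1
  have hmem : x₀ + s • x ∈ ball x₀ R := ray_mem_ball ⟨hs0, hs.2⟩ hx
  have hx1 : ‖x‖ ≤ 1 := by simpa using hx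
  obtain ⟨a1, a2, a3⟩ := hA _ hmem
  have hA0 : 0 ≤ A := (norm_nonneg _).trans a2
  have hC0 : 0 ≤ C := (norm_nonneg _).trans (h1 _ hmem)
  have e1 : (s ^ 2)⁻¹ ≤ (a ^ 2)⁻¹ := by gcongr; exact hs.1.le
  have e2 : (s ^ 3)⁻¹ ≤ (a ^ 3)⁻¹ := by gcongr; exact hs.1.le
  have e3 : ‖fderiv ℝ u (x₀ + s • x) x‖ ≤ C :=
    ((fderiv ℝ u (x₀ + s • x)).le_opNorm x).trans
      ((mul_le_of_le_one_right (norm_nonneg _) hx1).trans (h1 _ hmem))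
  have e4 : ‖smoothRhs g δ (u (x₀ + s • x))‖ ≤ A + (A + 1) * A := by
    refine (norm_smoothRhs_le _ hδ hδ1).trans (add_le_add a1 ?_)
    exact mul_le_mul (by linarith) a3 (norm_nonneg _) (by linarith)
  have e5 : |smoothPotential g δ (u (x₀ + s • x))| ≤ A * (A + 1) :=
    (abs_smoothPotential_le _ hδ hδ1).trans
      (mul_le_mul a1 (by linarith) (by positivity) hA0)
  refine (norm_sub_le _ _).trans (add_le_add ?_ ?_)
  · rw [norm_mul, Real.norm_of_nonneg (by positivity)]
    refine mul_le_mul e1 ?_ (norm_nonneg _) (by positivity)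
    exact (norm_inner_le_norm _ _).trans (mul_le_mul e4 e3 (norm_nonneg _) (by positivity))
  · rw [norm_mul, Real.norm_of_nonneg (by positivity), Real.norm_eq_abs]
    exact mul_le_mul (by linarith) e5 (abs_nonneg _) (by positivity)

/-- The terms with the derivative of `u` cancel. What is left is `2 s⁻³ (⟨rhs g u, u⟩ - g(u)|u|)`,
which is `2 s⁻³ |u| ⟨∇g(u), u⟩` by `inner_rhs_self`; substitute `u = s² u_s`. -/
lemma potentialDeriv_limit_identity {s : ℝ} (hs : s ≠ 0) (x : E n) :
    ((s ^ 2)⁻¹ * inner ℝ (rhs g (u (x₀ + s • x))) (fderiv ℝ u (x₀ + s • x) x)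
        - 2 * (s ^ 3)⁻¹ * (g (u (x₀ + s • x)) * ‖u (x₀ + s • x)‖))
      - inner ℝ (rhs g (u (x₀ + s • x))) (radialField u x₀ s x)
      = 2 * s * errorDensity g u x₀ s x := by
  rw [radialField, inner_sub_right, real_inner_smul_right, real_inner_smul_right, inner_rhs_self,
    errorDensity, rescale, real_inner_smul_right, norm_smul, Real.norm_of_nonneg (by positivity)]
  field_simp
  ring

end Energy

/-! ### Approximate energies and the limit formula. -/

section Formula

variable {n m : ℕ} {g : E m → ℝ} {θ : ℝ} {u : E n → E m} {x₀ : E n} {R : ℝ}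

lemma continuousOn_bulkTerm (hg : ContDiffOn ℝ 2 g (ball 0 θ)) (hu : ContinuousOn u (ball x₀ R))
    (hu' : ContinuousOn (fderiv ℝ u) (ball x₀ R)) (hθ : ∀ x ∈ ball x₀ R, ‖u x‖ < θ)
    {v : E n → E m} (hv : ContDiff ℝ ∞ v) {δ : ℝ} (hδ : 0 < δ) :
    ContinuousOn (Function.uncurry (bulkTerm g u v x₀ δ)) (Ioo 0 R ×ˢ closedBall 0 1) :=
  (continuousOn_potentialDeriv hg hδ hu hu' hθ).sub
    ((continuousOn_comp_ray (continuous_lap hv).continuousOn).inner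
      (continuousOn_radialField hv.continuous.continuousOn
        (hv.continuous_fderiv (by simp)).continuousOn))

lemma continuousOn_norm_sq_radialField (hu : ContinuousOn u (ball x₀ R))
    (hu' : ContinuousOn (fderiv ℝ u) (ball x₀ R)) :
    ContinuousOn (Function.uncurry fun s x => ‖radialField u x₀ s x‖ ^ 2)
      (Ioo 0 R ×ˢ closedBall 0 1) :=
  (continuousOn_radialField hu hu').norm.pow 2

lemma continuousOn_norm_sq_rescale (hu : ContinuousOn u (ball x₀ R)) :
    ContinuousOn (Function.uncurry fun s x => ‖rescale u x₀ s x‖ ^ 2)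
      (Ioo 0 R ×ˢ closedBall 0 1) :=
  (continuousOn_rescale hu).norm.pow 2

/-- The approximate energy of a smooth map `v` near `u`. -/
noncomputable def approxEnergy (g : E m → ℝ) (u v : E n → E m) (x₀ : E n) (δ s : ℝ) : ℝ :=
  (∫ x in ball (0 : E n) 1, gradDensity v x₀ s x)
    - (∫ x, ‖rescale v x₀ s x‖ ^ 2 ∂(surface 0 1))
    + ∫ x in ball (0 : E n) 1, (s ^ 2)⁻¹ * smoothPotential g δ (u (x₀ + s • x))

/-- The derivative of the approximate energy. -/
noncomputable def approxEnergyDeriv (g : E m → ℝ) (u v : E n → E m) (x₀ : E n) (δ s : ℝ) : ℝ :=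
  s * (∫ x, ‖radialField v x₀ s x‖ ^ 2 ∂(surface 0 1))
    + ∫ x in ball (0 : E n) 1, bulkTerm g u v x₀ δ s x

lemma hasDerivAt_approxEnergy (hg : ContDiffOn ℝ 2 g (ball 0 θ)) (hu : ContinuousOn u (ball x₀ R))
    (hu' : ContinuousOn (fderiv ℝ u) (ball x₀ R)) (hud : ∀ x ∈ ball x₀ R, DifferentiableAt ℝ u x)
    (hθ : ∀ x ∈ ball x₀ R, ‖u x‖ < θ) {v : E n → E m} (hv : ContDiff ℝ ∞ v) {δ : ℝ} (hδ : 0 < δ)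
    {s : ℝ} (hs : s ∈ Ioo 0 R) :
    HasDerivAt (approxEnergy g u v x₀ δ) (approxEnergyDeriv g u v x₀ δ s) s := by
  have h := (hasDerivAt_smooth_energy hv x₀ hs.1).add
    (hasDerivAt_integral_potential hg hδ hu hu' hud hθ hs)
  refine h.congr_deriv ?_
  have hK : IsCompact (closedBall (0 : E n) 1) := isCompact_closedBall 0 1
  have h1 : ContinuousOn
      (Function.uncurry fun s x => inner ℝ (lap v (x₀ + s • x)) (radialField v x₀ s x))
      (Ioo 0 R ×ˢ closedBall 0 1) :=
    (continuousOn_comp_ray (continuous_lap hv).continuousOn).inner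
      (continuousOn_radialField hv.continuous.continuousOn
        (hv.continuous_fderiv (by simp)).continuousOn)
  simp only [approxEnergyDeriv, bulkTerm]
  rw [integral_sub
    (integrable_of_continuousOn hK ae_restrict_ball_mem
      (continuousOn_slice (continuousOn_potentialDeriv hg hδ hu hu' hθ) hs))
    (integrable_of_continuousOn hK ae_restrict_ball_mem (continuousOn_slice h1 hs))]
  ring

lemma continuousOn_approxEnergyDeriv (hg : ContDiffOn ℝ 2 g (ball 0 θ))
    (hu : ContinuousOn u (ball x₀ R)) (hu' : ContinuousOn (fderiv ℝ u) (ball x₀ R))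
    (hθ : ∀ x ∈ ball x₀ R, ‖u x‖ < θ) {v : E n → E m} (hv : ContDiff ℝ ∞ v) {δ : ℝ} (hδ : 0 < δ) :
    ContinuousOn (approxEnergyDeriv g u v x₀ δ) (Ioo 0 R) :=
  (continuousOn_id.mul (continuousOn_integral_of_compact (isCompact_closedBall 0 1)
    ae_surface_mem_closedBall (continuousOn_norm_sq_radialField hv.continuous.continuousOn
      (hv.continuous_fderiv (by simp)).continuousOn))).add
    (continuousOn_integral_of_compact (isCompact_closedBall 0 1) ae_restrict_ball_mem
      (continuousOn_bulkTerm hg hu hu' hθ hv hδ))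

/-- The derivative of the Weiss energy on the ball of continuous differentiability. -/
theorem hasDerivAt_weiss_of_approximation {G : Fin n → E n → E m} (hn : 0 < n)
    (hg : ContDiffOn ℝ 2 g (ball 0 θ)) (hu : ContinuousOn u (ball x₀ R))
    (hu' : ContinuousOn (fderiv ℝ u) (ball x₀ R)) (hud : ∀ x ∈ ball x₀ R, DifferentiableAt ℝ u x)
    (hθ : ∀ x ∈ ball x₀ R, ‖u x‖ < θ)
    (hG : ∀ i, ∀ᵐ x ∂(volume.restrict (ball x₀ R)), G i x = vpartial i u x)
    {v : ℕ → E n → E m} {A C : ℝ} (hv : ∀ k, ContDiff ℝ ∞ (v k))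
    (hv0 : ∀ x ∈ ball x₀ R, Tendsto (fun k => v k x) atTop (𝓝 (u x)))
    (hv1 : ∀ x ∈ ball x₀ R, Tendsto (fun k => fderiv ℝ (v k) x) atTop (𝓝 (fderiv ℝ u x)))
    (hC0 : ∀ k, ∀ x ∈ ball x₀ R, ‖v k x‖ ≤ C) (hC1 : ∀ k, ∀ x ∈ ball x₀ R, ‖fderiv ℝ (v k) x‖ ≤ C)
    (hC2 : ∀ k, ∀ x ∈ ball x₀ R, ‖lap (v k) x‖ ≤ C)
    (hlap : ∀ᵐ x ∂(volume.restrict (ball x₀ R)),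
      Tendsto (fun k => lap (v k) x) atTop (𝓝 (rhs g (u x))))
    (hA : ∀ x ∈ ball x₀ R, |g (u x)| ≤ A ∧ ‖u x‖ ≤ A ∧ ‖gradient g (u x)‖ ≤ A)
    {r : ℝ} (hr : r ∈ Ioo 0 R) :
    HasDerivAt (weiss g u G x₀)
      (r * (∫ x, ‖radialField u x₀ r x‖ ^ 2 ∂(surface 0 1))
        + 2 * r * ∫ x in ball (0 : E n) 1, errorDensity g u x₀ r x) r := by
  have hK : IsCompact (closedBall (0 : E n) 1) := isCompact_closedBall 0 1
  obtain ⟨a, ha, har⟩ := exists_between hr.1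
  have hsub : Ioo a R ⊆ Ioo 0 R := Ioo_subset_Ioo_left ha.le
  have hx₀ : x₀ ∈ ball x₀ R := mem_ball_self (hr.1.trans hr.2)
  have hC : 0 ≤ C := (norm_nonneg _).trans (hC0 0 x₀ hx₀)
  have hA0 : 0 ≤ A := (abs_nonneg _).trans (hA x₀ hx₀).1
  have hCu : ∀ x ∈ ball x₀ R, ‖fderiv ℝ u x‖ ≤ C := fun x hx =>
    le_of_tendsto (hv1 x hx).norm (Eventually.of_forall fun k => hC1 k x hx)
  let δ : ℕ → ℝ := fun k => 1 / ((k : ℝ) + 1)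
  have hδ : ∀ k, 0 < δ k := fun k => by positivity
  have hδ1 : ∀ k, δ k ≤ 1 := fun k => div_le_one_of_le₀ (by simp) (by positivity)
  have hδt : Tendsto δ atTop (𝓝 0) := tendsto_one_div_add_atTop_nhds_zero_nat
  have hvc : ∀ k, ContinuousOn (v k) (ball x₀ R) := fun k => (hv k).continuous.continuousOn
  have hvc' : ∀ k, ContinuousOn (fderiv ℝ (v k)) (ball x₀ R) := fun k =>
    ((hv k).continuous_fderiv (by simp)).continuousOn
  have hrad : ∀ s ∈ Ioo 0 R, ∀ x ∈ closedBall (0 : E n) 1,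
      Tendsto (fun k => radialField (v k) x₀ s x) atTop (𝓝 (radialField u x₀ s x)) := by
    intro s hs x hx
    have hmem := ray_mem_ball (x₀ := x₀) hs hx
    exact ((((ContinuousLinearMap.apply ℝ (E m) x).continuous.tendsto _).comp
      (hv1 _ hmem)).const_smul _).sub ((hv0 _ hmem).const_smul _)
  set Z := (a ^ 2)⁻¹ * C + 2 * (a ^ 3)⁻¹ * C with hZ
  set P := (a ^ 2)⁻¹ * ((A + (A + 1) * A) * C) + 2 * (a ^ 3)⁻¹ * (A * (A + 1)) with hP
  have hradb : ∀ k, ∀ s ∈ Ioo a R, ∀ x ∈ closedBall (0 : E n) 1,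
      ‖‖radialField (v k) x₀ s x‖ ^ 2‖ ≤ Z ^ 2 := fun k s hs x hx => by
    rw [Real.norm_of_nonneg (by positivity)]
    have := norm_radialField_le (v := v k) ha (hC0 k) (hC1 k) hs hx
    gcongr
  have hbulk : ∀ k, ∀ s ∈ Ioo a R, ∀ x ∈ closedBall (0 : E n) 1,
      ‖bulkTerm g u (v k) x₀ (δ k) s x‖ ≤ P + C * Z := fun k s hs x hx => by
    have hmem := ray_mem_ball (x₀ := x₀) (hsub hs) hx
    refine (norm_sub_le _ _).trans (add_le_add
      (norm_potentialDeriv_le ha (hδ k).le (hδ1 k) hA hCu hs hx) ?_)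
    exact (norm_inner_le_norm _ _).trans (mul_le_mul (hC2 k _ hmem)
      (norm_radialField_le ha (hC0 k) (hC1 k) hs hx) (norm_nonneg _) hC)
  have hT' : ContinuousOn (fun s => s * (∫ x, ‖radialField u x₀ s x‖ ^ 2 ∂(surface 0 1))
        + 2 * s * ∫ x in ball (0 : E n) 1, errorDensity g u x₀ s x) (Ioo 0 R) :=
    (continuousOn_id.mul (continuousOn_integral_of_compact hK ae_surface_mem_closedBall
      (continuousOn_norm_sq_radialField hu hu'))).add
      ((continuousOn_const.mul continuousOn_id).mul (continuousOn_integral_of_compact hK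
        ae_restrict_ball_mem (continuousOn_errorDensity hg hu hθ)))
  refine hasDerivAt_of_tendsto_of_bounded (a := a) (b := R)
    (W := fun k => approxEnergy g u (v k) x₀ (δ k))
    (T := fun k => approxEnergyDeriv g u (v k) x₀ (δ k))
    (T' := fun s => s * (∫ x, ‖radialField u x₀ s x‖ ^ 2 ∂(surface 0 1))
        + 2 * s * ∫ x in ball (0 : E n) 1, errorDensity g u x₀ s x)
    (C := R * (Z ^ 2 * (surface (0 : E n) 1).real univ)
      + (P + C * Z) * ((volume : Measure (E n)).restrict (ball 0 1)).real univ)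
    (fun k s hs => hasDerivAt_approxEnergy hg hu hu' hud hθ (hv k) (hδ k) (hsub hs))
    (fun k => (continuousOn_approxEnergyDeriv hg hu hu' hθ (hv k) (hδ k)).mono hsub)
    (hT'.mono hsub) ?_ ?_ ?_ ⟨har, hr.2⟩
  · intro k s hs
    have hs0 : 0 < s := (hsub hs).1
    refine (norm_add_le _ _).trans (add_le_add ?_ ?_)
    · rw [norm_mul, Real.norm_of_nonneg hs0.le]
      exact mul_le_mul hs.2.le (norm_integral_le_of_norm_le_const
        (ae_surface_mem_closedBall.mono fun x hx => hradb k s hs x hx)) (norm_nonneg _)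
        (hs0.trans hs.2).le
    · exact norm_integral_le_of_norm_le_const
        (ae_restrict_ball_mem.mono fun x hx => hbulk k s hs x hx)
  · intro s hs
    have hs' := hsub hs
    rw [weiss_eq hn hg hu hu' hθ hG hs']
    refine ((tendsto_integral_of_compact (C := 1 / 2 * ∑ _i : Fin n, (s⁻¹ * C) ^ 2)
      hK ae_restrict_ball_mem
      (fun k => continuousOn_slice (continuousOn_gradDensity (hvc' k)) hs') ?_ ?_).sub
      (tendsto_integral_of_compact (C := ((s ^ 2)⁻¹ * C) ^ 2) hK ae_surface_mem_closedBall
      (fun k => continuousOn_slice (continuousOn_norm_sq_rescale (hvc k)) hs') ?_ ?_)).add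
      (tendsto_integral_of_compact (C := (s ^ 2)⁻¹ * (A * (A + 1))) hK ae_restrict_ball_mem
      (fun k => continuousOn_slice (continuousOn_potential hg hu hθ) hs') ?_ ?_)
    · intro k x hx
      have hmem := ray_mem_ball (x₀ := x₀) hs' hx
      rw [gradDensity, Real.norm_of_nonneg (by positivity)]
      gcongr with i
      rw [norm_smul, Real.norm_of_nonneg (inv_nonneg.2 hs'.1.le)]
      have : ‖vpartial i (v k) (x₀ + s • x)‖ ≤ C :=
        ((fderiv ℝ (v k) (x₀ + s • x)).le_opNorm _).trans (by simpa using hC1 k _ hmem)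
      exact mul_le_mul_of_nonneg_left this (inv_nonneg.2 hs'.1.le)
    · refine ae_restrict_ball_mem.mono fun x hx => ?_
      have hmem := ray_mem_ball (x₀ := x₀) hs' hx
      refine Tendsto.const_mul _ (tendsto_finsetSum _ fun i _ => ?_)
      exact ((((ContinuousLinearMap.apply ℝ (E m) (basisVec i)).continuous.tendsto _).comp
        (hv1 _ hmem)).const_smul _).norm.pow 2
    · intro k x hx
      have hmem := ray_mem_ball (x₀ := x₀) hs' hx
      rw [Real.norm_of_nonneg (by positivity), rescale, norm_smul,
        Real.norm_of_nonneg (by positivity)]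
      have := hC0 k _ hmem
      gcongr
    · refine ae_surface_mem_closedBall.mono fun x hx => ?_
      exact ((hv0 _ (ray_mem_ball hs' hx)).const_smul _).norm.pow 2
    · intro k x hx
      obtain ⟨a1, a2, -⟩ := hA _ (ray_mem_ball (x₀ := x₀) hs' hx)
      rw [norm_mul, Real.norm_of_nonneg (by positivity), Real.norm_eq_abs]
      refine mul_le_mul_of_nonneg_left ?_ (by positivity)
      exact (abs_smoothPotential_le _ (hδ k).le (hδ1 k)).trans
        (mul_le_mul a1 (by linarith) (by positivity) hA0)
    · exact Eventually.of_forall fun x => (tendsto_smoothPotential _ hδt).const_mul _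
  · intro s hs
    have hs' := hsub hs
    have hlap' := ae_comp_ray hs' hlap
    rw [← integral_const_mul (2 * s)]
    refine ((tendsto_integral_of_compact (C := Z ^ 2) hK ae_surface_mem_closedBall
      (fun k => continuousOn_slice
        (continuousOn_norm_sq_radialField (hvc k) (hvc' k)) hs') (fun k => hradb k s hs)
      ?_).const_mul s).add
      (tendsto_integral_of_compact (C := P + C * Z) hK ae_restrict_ball_mem
      (fun k => continuousOn_slice
        (continuousOn_bulkTerm hg hu hu' hθ (hv k) (hδ k)) hs') (fun k => hbulk k s hs) ?_)
    · exact ae_surface_mem_closedBall.mono fun x hx => (hrad s hs' x hx).norm.pow 2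
    -- The radius is fixed here, so almost everywhere convergence of the Laplacians transfers to the
    -- unit ball and the integrand converges to the one in the cancellation identity.
    · filter_upwards [ae_restrict_ball_mem, hlap'] with x hx hlx
      rw [← potentialDeriv_limit_identity hs'.1.ne' x]
      exact ((((tendsto_smoothRhs _ hδt).inner tendsto_const_nhds).const_mul _).sub
        ((tendsto_smoothPotential _ hδt).const_mul _)).sub (hlx.inner (hrad s hs' x hx))

end Formula

end WeissFormula

/-! ### The monotonicity formula. -/

theorem mainTheorem8 (n m : ℕ) (hn : 0 < n) (hm : 0 < m) (θ : ℝ)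
    (g : WeissFormula.E m → ℝ) (hg : ContDiffOn ℝ 2 g (ball 0 θ))
    (x₀ : WeissFormula.E n) (R : ℝ)
    (u : WeissFormula.E n → WeissFormula.E m)
    (G : Fin n → WeissFormula.E n → WeissFormula.E m)
    (hu : WeissFormula.IsSolution g (ball x₀ R) u G)
    (hθ : ∀ x ∈ ball x₀ R, ‖u x‖ < θ)
    (r : ℝ) (hr : 0 < r) (hrR : r < R) :
    -- all the quantities in the formula are well defined
    IntegrableOn (WeissFormula.density g u G) (ball x₀ r) ∧
    Integrable (fun x => ‖u x‖ ^ 2) (WeissFormula.surface x₀ r) ∧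
    (∀ x ∈ closedBall (0 : WeissFormula.E n) 1,
      DifferentiableAt ℝ (fun s => WeissFormula.rescale u x₀ s x) r) ∧
    Integrable (fun x => ‖WeissFormula.rescaleDeriv u x₀ r x‖ ^ 2) (WeissFormula.surface 0 1) ∧
    IntegrableOn (WeissFormula.errorDensity g u x₀ r) (ball 0 1) ∧
    -- the formula
    HasDerivAt (fun s => WeissFormula.weiss g u G x₀ s)
      (r * (∫ x, ‖WeissFormula.rescaleDeriv u x₀ r x‖ ^ 2 ∂(WeissFormula.surface 0 1))
        + 2 * r * (∫ x in ball 0 1, WeissFormula.errorDensity g u x₀ r x)) r := by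
  open WeissFormula Filter in
  obtain ⟨R', hrR', hR'R⟩ := exists_between hrR
  have hrmem : r ∈ Ioo 0 R' := ⟨hr, hrR'⟩
  have hsub : ball x₀ R' ⊆ ball x₀ R := ball_subset_ball hR'R.le
  have hK' : closedBall x₀ R' ⊆ ball x₀ R := closedBall_subset_ball hR'R
  have hK : IsCompact (closedBall (0 : E n) 1) := isCompact_closedBall 0 1
  obtain ⟨v, C, hv, hud, hu', hv0, hv1, hC0, hC1, hC2, hlap, hG⟩ :=
    hu.exists_approximation hg hθ hR'R
  have huc := hu.continuousOn.mono hsub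
  have hθ' : ∀ x ∈ ball x₀ R', ‖u x‖ < θ := fun x hx => hθ x (hsub hx)
  have hud' : ∀ x ∈ ball x₀ R', DifferentiableAt ℝ u x := fun x hx => (hud x hx).differentiableAt
  obtain ⟨A, hA⟩ : ∃ A, ∀ x ∈ ball x₀ R',
      |g (u x)| ≤ A ∧ ‖u x‖ ≤ A ∧ ‖gradient g (u x)‖ ≤ A := by
    have hcomp := isCompact_closedBall x₀ R'
    obtain ⟨A₁, h1⟩ := hcomp.exists_bound_of_continuousOn
      ((continuousOn_comp_of_contDiffOn hg hu.continuousOn hθ).mono hK')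
    obtain ⟨A₂, h2⟩ := hcomp.exists_bound_of_continuousOn (hu.continuousOn.mono hK')
    obtain ⟨A₃, h3⟩ := hcomp.exists_bound_of_continuousOn
      ((continuousOn_comp_gradient hg hu.continuousOn hθ).mono hK')
    refine ⟨max A₁ (max A₂ A₃), fun x hx => ⟨?_, ?_, ?_⟩⟩
    · exact (h1 x (ball_subset_closedBall hx)).trans (le_max_left _ _)
    · exact (h2 x (ball_subset_closedBall hx)).trans
        ((le_max_left _ _).trans (le_max_right _ _))
    · exact (h3 x (ball_subset_closedBall hx)).trans
        ((le_max_right _ _).trans (le_max_right _ _))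
  have hrad : ∀ x ∈ closedBall (0 : E n) 1,
      HasDerivAt (fun s => rescale u x₀ s x) (radialField u x₀ r x) r := fun x hx =>
    hasDerivAt_rescale hr.ne' (hud' _ (ray_mem_ball hrmem hx))
  -- The rays are known to be differentiable at `r` only for `x` in the closed unit ball, which
  -- carries the surface measure.
  have hae : (fun x => ‖rescaleDeriv u x₀ r x‖ ^ 2)
      =ᵐ[surface 0 1] fun x => ‖radialField u x₀ r x‖ ^ 2 :=
    ae_surface_mem_closedBall.mono fun x hx => by
      simp only [rescaleDeriv, (hrad x hx).deriv]
  refine ⟨?_, ?_, fun x hx => (hrad x hx).differentiableAt, ?_, ?_, ?_⟩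
  · have hcb : closedBall x₀ r ⊆ ball x₀ R' := closedBall_subset_ball hrR'
    have hc : ContinuousOn (density g u fun i => vpartial i u) (ball x₀ R') :=
      (continuousOn_const.mul (continuousOn_finsetSum _ fun i _ =>
        (hu'.clm_apply continuousOn_const).norm.pow 2)).add
        ((continuousOn_comp_of_contDiffOn hg huc hθ').mul huc.norm)
    have hi : IntegrableOn (density g u fun i => vpartial i u) (ball x₀ r) :=
      ((hc.mono hcb).integrableOn_compact (isCompact_closedBall x₀ r)).mono_set
        ball_subset_closedBall
    refine hi.congr ?_
    have := ae_all_iff.2 fun i => ae_restrict_of_ae_restrict_of_subset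
      (ball_subset_ball hrR'.le) (hG i)
    filter_upwards [this] with x hx
    simp only [density, hx]
  · exact integrable_of_continuousOn (isCompact_closedBall x₀ r)
      ((ae_surface_mem x₀ hr.le).mono fun x hx => sphere_subset_closedBall hx)
      ((huc.mono (closedBall_subset_ball hrR')).norm.pow 2)
  · exact (integrable_of_continuousOn hK ae_surface_mem_closedBall
      (continuousOn_slice (continuousOn_norm_sq_radialField huc hu') hrmem)).congr hae.symm
  · exact integrable_of_continuousOn hK ae_restrict_ball_mem
      (continuousOn_slice (continuousOn_errorDensity hg huc hθ') hrmem)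
  · rw [integral_congr_ae hae]
    exact hasDerivAt_weiss_of_approximation hn hg huc hu' hud' hθ' hG hv hv0 hv1 hC0 hC1 hC2
      hlap hA hrmem
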